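/- Fix an integer $\ell\ge 2$. **Fermions.** Let $\mathcal A$ be the associative $\mathbb C$-algebra generated by $\psi_i,\psi_i^*$ ($i\in\mathbb Z+\frac12$) with relations $\psi_i\psi_j+\psi_j\psi_i=\psi_i^*\psi_j^*+\psi_j^*\psi_i^*=0$ and $\psi_i^*\psi_j+\psi_j\psi_i^*=\delta_{i+j,0}$, and let $F_{\mathcal A}=\mathcal A\,\mathbf{vac}_{\mathcal A}$ be the fermionic Fock space, i.e. the left $\mathcal A$-module generated by $\mathbf{vac}_{\mathcal A}$ subject to $\psi_i\mathbf{vac}_{\mathcal A}=\psi^*_i\mathbf{vac}_{\mathcal A}=0$ for $i>0$. Put $\psi(\lambda)=\sum_i\psi_i\lambda^{-i-1/2}$ and $\psi^*(\lambda)=\sum_i\psi^*_i\lambda^{-i-1/2}$. Let $:\!\psi_i\psi_j^*\!:$ be $\psi_i\psi_j^*$ if $i<0$ or $j>0$, and $-\psi_j^*\psi_i$ otherwise. For $X\in\mathfrak{sl}_\ell(\mathbb C)$ (rows and columns numbered $0,\dots,\ell-1$) and $n\in\mathbb Z$, the element $Xs^n$ acts on $F_{\mathcal A}$ by $$\pi(Xs^n)=\sum_{r\in\mathbb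 Z}\sum_{a,b=0}^{\ell-1}X_{ab}:\!\psi_{-(a+r\ell+\frac12)}\,\psi^*_{b+(r+n)\ell+\frac12}\!:\,,$$ and $X^\pi(z)=\sum_n\pi(Xs^n)z^{-n-1}$. **Bosons.** Let $F_{\mathfrak d}=\mathbb C[y_{n\ell},y^*_{n\ell}\;(n\ge1)]\otimes\mathbb C[e^{y_0},e^{-y_0}]$, $\mathbf{vac}_{\mathfrak d}=1$, and for $m\in\mathbb Z$ $$V_m(z)=\exp\Bigl(m\sum_{n>0}y_{n\ell}z^n\Bigr)e^{my_0}\exp\Bigl(-m\sum_{n>0}\frac1n\frac{\partial}{\partial y^*_{n\ell}}z^{-n}\Bigr).$$ **The group.** Let $R=\mathbb C[s^{\pm1},t^{\pm1}]$. The space $\mathfrak{sl}_\ell\otimes R$ acts linearly on $F^{\mathrm{tor}}_{\mathcal A}=F_{\mathcal A}\otimes F_{\mathfrak d}$ by letting $X\otimes s^nt^m$ act as the coefficient of $z^{-n-1}$ in $X^\pi(z)V_m(z)$. Let $\mathrm{SL}_\ell^{\mathrm{tor}}$ be the group of invertible linear transformations of $F^{\mathrm{tor}}_{\mathcal A}$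 generated by the exponentials of those elements of $\mathfrak{sl}_\ell\otimes R$ that act locally nilpotently. **The bilinear operator.** Let $$\Omega^{\mathrm{tor}}_{\mathcal A}(\lambda)=\sum_{m\in\mathbb Z}\psi(\lambda)V_m(\lambda^\ell)\otimes\psi^*(\lambda)V_{-m}(\lambda^\ell).$$ Each coefficient of $\lambda^c$ is a map from $F^{\mathrm{tor}}_{\mathcal A}\otimes F^{\mathrm{tor}}_{\mathcal A}$ to its completion consisting of arbitrary (possibly infinite) sums $\sum_{a,b\in\mathbb Z}u_{a,b}\,(e^{ay_0}\otimes e^{by_0})$; only finitely many $m$ contribute to each coefficient $u_{a,b}$. **Statement.** For every $\tau$ in the $\mathrm{SL}_\ell^{\mathrm{tor}}$-orbit of $\mathbf{vac}_{\mathcal A}\otimes\mathbf{vac}_{\mathfrak d}$, $$\oint\lambda^{j\ell}\,\Omega^{\mathrm{tor}}_{\mathcal A}(\lambda)(\tau\otimes\tau)\,d\lambda=0\qquad\text{for all integers } j\ge0,$$ where $\oint$ is formal: up to the factor $2\pi i$ it extracts the coefficient of $\lambda^{-1}$. -/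

import Mathlib

open scoped TensorProduct LaurentPolynomial

noncomputable section

namespace Toroidal

/-! ### Locally finite sums of linear maps and products of vertex operators -/

section General

variable {ι U V W : Type*} [AddCommGroup U] [Module ℂ U] [AddCommGroup V] [Module ℂ V]
  [AddCommGroup W] [Module ℂ W]

/-- The pointwise finite sum `v ↦ ∑ i, f i v` of a locally finite family of linear maps. -/
def locSum (f : ι → V →ₗ[ℂ] W) (hf : ∀ v, (Function.support fun i => f i v).Finite) :
    V →ₗ[ℂ] W where
  toFun v := ∑ᶠ i, f i v
  map_add' v w := by
    simp only [map_add]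
    exact finsum_add_distrib (hf v) (hf w)
  map_smul' c v := by
    simp only [map_smul, RingHom.id_apply]
    exact (smul_finsum c _).symm

theorem locSum_apply (f : ι → V →ₗ[ℂ] W) (hf) (v : V) : locSum f hf v = ∑ᶠ i, f i v := rfl

theorem map_locSum (g : W →ₗ[ℂ] U) (f : ι → V →ₗ[ℂ] W) (hf) (v : V) :
    g (locSum f hf v) = ∑ᶠ i, g (f i v) :=
  AddMonoidHom.map_finsum g.toAddMonoidHom (hf v)

/-- The coefficients of a vertex operator vanish on a given vector in low degrees. -/
theorem coeff_bdd (A : VertexOperator ℂ V) (v : V) :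
    ∃ N : ℤ, ∀ k < N, HVertexOperator.coeff A k v = 0 :=
  ⟨_, fun k hk => VertexOperator.coeff_eq_zero_of_lt_order A k v hk⟩

theorem bddBelow_of_forall {V : Type*} [Zero V] {f : ℤ → V} (N : ℤ) (h : ∀ k < N, f k = 0) :
    BddBelow (Function.support f) :=
  ⟨N, fun k hk => not_lt.1 fun hlt => hk (h k hlt)⟩

theorem tensor_support_finite (A : VertexOperator ℂ V) (B : VertexOperator ℂ W) (k : ℤ)
    (u : V ⊗[ℂ] W) : (Function.support fun a : ℤ =>
      TensorProduct.map (HVertexOperator.coeff A a) (HVertexOperator.coeff B (k - a)) u).Finite := by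
  induction u using TensorProduct.induction_on with
  | zero => simp
  | tmul v w =>
    obtain ⟨N, hN⟩ := coeff_bdd A v
    obtain ⟨M, hM⟩ := coeff_bdd B w
    refine (Set.finite_Icc N (k - M)).subset fun a ha => ?_
    rw [Function.mem_support, TensorProduct.map_tmul] at ha
    refine ⟨not_lt.1 fun h => ha (by rw [hN a h, TensorProduct.zero_tmul]), not_lt.1 fun h => ha ?_⟩
    rw [hM (k - a) (by linarith), TensorProduct.tmul_zero]
  | add x y hx hy =>
    refine (hx.union hy).subset ?_
    simp only [map_add]
    exact Function.support_add _ _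

/-- The `z ^ k` coefficient of `A(z) ⊗ B(z)`. -/
def tensorCoeff (A : VertexOperator ℂ V) (B : VertexOperator ℂ W) (k : ℤ) :
    Module.End ℂ (V ⊗[ℂ] W) :=
  locSum (fun a : ℤ =>
    TensorProduct.map (HVertexOperator.coeff A a) (HVertexOperator.coeff B (k - a)))
    (tensor_support_finite A B k)

theorem tensorCoeff_bdd (A : VertexOperator ℂ V) (B : VertexOperator ℂ W) (u : V ⊗[ℂ] W) :
    BddBelow (Function.support fun k => tensorCoeff A B k u) := by
  induction u using TensorProduct.induction_on with
  | zero => simp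
  | tmul v w =>
    obtain ⟨N, hN⟩ := coeff_bdd A v
    obtain ⟨M, hM⟩ := coeff_bdd B w
    refine bddBelow_of_forall (N + M) fun k hk => ?_
    rw [tensorCoeff, locSum_apply]
    refine (finsum_congr fun a => ?_).trans finsum_zero
    rw [TensorProduct.map_tmul]
    rcases lt_or_ge a N with h | h
    · rw [hN a h, TensorProduct.zero_tmul]
    · rw [hM (k - a) (by linarith), TensorProduct.tmul_zero]
  | add x y hx hy =>
    refine (hx.union hy).mono ?_
    simp only [map_add]
    exact Function.support_add _ _

/-- The product `A(z) ⊗ B(z)` acting on `V ⊗ W`. -/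
def tensorField (A : VertexOperator ℂ V) (B : VertexOperator ℂ W) :
    VertexOperator ℂ (V ⊗[ℂ] W) :=
  VertexOperator.of_coeff (tensorCoeff A B) (tensorCoeff_bdd A B)

/-- The substitution `A(λ ^ ℓ)` for `ℓ ≥ 1`. -/
def substPow (ℓ : ℕ) [NeZero ℓ] (A : VertexOperator ℂ V) : VertexOperator ℂ V :=
  VertexOperator.of_coeff
    (fun c => if (ℓ : ℤ) ∣ c then HVertexOperator.coeff A (c / ℓ) else 0) fun v => by
      obtain ⟨N, hN⟩ := coeff_bdd A v
      refine bddBelow_of_forall (ℓ * N) fun k hk => ?_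
      have hℓ : (0 : ℤ) < ℓ := by exact_mod_cast Nat.pos_of_neZero ℓ
      split_ifs with h
      · exact hN _ (Int.ediv_lt_of_lt_mul hℓ (by linarith))
      · rfl

/-- The exponential `∑ f ^ k / k!` of a power series without constant term over a (possibly
noncommutative) `ℂ`-algebra. Only the terms with `k ≤ n` contribute to the `n`-th coefficient. -/
def expSeries {E : Type*} [Ring E] [Algebra ℂ E] (f : PowerSeries E) : PowerSeries E :=
  PowerSeries.mk fun n =>
    ∑ k ∈ Finset.range (n + 1), ((k.factorial : ℂ)⁻¹) • PowerSeries.coeff n (f ^ k)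

end General

/-! ### The Heisenberg Fock space `F_𝔡` and the vertex operators `V_m(z)` -/

/-- The polynomial ring in the variables `y_{nℓ}` (`Sum.inl n`) and `y*_{nℓ}` (`Sum.inr n`),
`n ≥ 1`. -/
abbrev YPoly : Type := MvPolynomial (ℕ+ ⊕ ℕ+) ℂ

/-- `F_𝔡 = ℂ[y_{nℓ}, y*_{nℓ} (n ≥ 1)] ⊗ ℂ[e^{y₀}, e^{-y₀}]`. -/
abbrev FD : Type := YPoly ⊗[ℂ] ℂ[T;T⁻¹]

/-- The vacuum vector of `F_𝔡`. -/
def vacD : FD := 1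

/-- Multiplication by `y_{nℓ}`. -/
def yMul (n : ℕ+) : Module.End ℂ YPoly := LinearMap.mulLeft ℂ (MvPolynomial.X (Sum.inl n))

/-- The derivation `∂/∂y*_{nℓ}`. -/
def yStarDeriv (n : ℕ+) : Module.End ℂ YPoly :=
  (MvPolynomial.pderiv (R := ℂ) (Sum.inr n)).toLinearMap

/-- The operator-valued series `m ∑_{n>0} y_{nℓ} zⁿ`. -/
def creationExponent (m : ℤ) : PowerSeries (Module.End ℂ YPoly) :=
  PowerSeries.mk fun n => if h : 0 < n then (m : ℂ) • yMul ⟨n, h⟩ else 0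

/-- The operator-valued series `- m ∑_{n>0} (1/n) (∂/∂y*_{nℓ}) wⁿ`, where `w = z⁻¹`. -/
def annihilationExponent (m : ℤ) : PowerSeries (Module.End ℂ YPoly) :=
  PowerSeries.mk fun n => if h : 0 < n then (-(m : ℂ) * (n : ℂ)⁻¹) • yStarDeriv ⟨n, h⟩ else 0

/-- The `z ^ k` coefficient of `exp (m ∑ y_{nℓ} zⁿ)`, `k : ℤ`. -/
def creationCoeff (m k : ℤ) : Module.End ℂ YPoly :=
  if 0 ≤ k then PowerSeries.coeff k.toNat (expSeries (creationExponent m)) else 0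

/-- The `z ^ (-b)` coefficient of `exp (- m ∑ (1/n) (∂/∂y*_{nℓ}) z⁻ⁿ)`. -/
def annihilationCoeff (m : ℤ) (b : ℕ) : Module.End ℂ YPoly :=
  PowerSeries.coeff b (expSeries (annihilationExponent m))

/-- The weight of a monomial, `y*_{nℓ}` having weight `n`. -/
def starWeight (s : (ℕ+ ⊕ ℕ+) →₀ ℕ) : ℤ :=
  s.sum fun i e => (e : ℤ) * Sum.elim (fun _ => 0) (fun n : ℕ+ => (n : ℤ)) i

theorem starWeight_nonneg (s : (ℕ+ ⊕ ℕ+) →₀ ℕ) : 0 ≤ starWeight s := by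
  refine Finset.sum_nonneg fun i _ => mul_nonneg (by positivity) ?_
  cases i <;> simp

/-- The span of the monomials of weight at most `N`. -/
def weightLE (N : ℤ) : Submodule ℂ YPoly :=
  Submodule.span ℂ {p | ∃ s c, starWeight s ≤ N ∧ p = MvPolynomial.monomial s c}

theorem weightLE_mono {N M : ℤ} (h : N ≤ M) : weightLE N ≤ weightLE M :=
  Submodule.span_mono fun _ ⟨s, c, hs, hp⟩ => ⟨s, c, hs.trans h, hp⟩

theorem weightLE_neg {N : ℤ} (h : N < 0) : weightLE N = ⊥ := by
  rw [eq_bot_iff, weightLE, Submodule.span_le]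
  rintro _ ⟨s, c, hs, -⟩
  exact absurd (starWeight_nonneg s) (by linarith)

theorem exists_weightLE (p : YPoly) : ∃ N, p ∈ weightLE N := by
  induction p using MvPolynomial.induction_on' with
  | monomial s c => exact ⟨_, Submodule.subset_span ⟨s, c, le_rfl, rfl⟩⟩
  | add p q hp hq =>
    obtain ⟨N, hN⟩ := hp
    obtain ⟨M, hM⟩ := hq
    exact ⟨max N M, add_mem (weightLE_mono (le_max_left _ _) hN)
      (weightLE_mono (le_max_right _ _) hM)⟩

theorem pderiv_mem_weightLE (n : ℕ+) {N : ℤ} {p : YPoly} (hp : p ∈ weightLE N) :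
    MvPolynomial.pderiv (R := ℂ) (Sum.inr n) p ∈ weightLE (N - n) := by
  induction hp using Submodule.span_induction with
  | mem x hx =>
    obtain ⟨s, c, hs, rfl⟩ := hx
    rw [MvPolynomial.pderiv_monomial]
    by_cases h : s (Sum.inr n) = 0
    · simp [h]
    · refine Submodule.subset_span ⟨_, _, ?_, rfl⟩
      have h1 : s = (s - Finsupp.single (Sum.inr n) 1) + Finsupp.single (Sum.inr n) 1 := by
        rw [tsub_add_cancel_of_le]
        simpa using Nat.one_le_iff_ne_zero.2 h
      have h2 : starWeight s = starWeight (s - Finsupp.single (Sum.inr n) 1) + n := by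
        conv_lhs => rw [h1]
        unfold starWeight
        rw [Finsupp.sum_add_index', Finsupp.sum_single_index] <;> simp [add_mul]
      linarith
  | zero => simp
  | add x y _ _ hx hy => rw [map_add]; exact add_mem hx hy
  | smul c x _ hx => rw [Derivation.map_smul]; exact Submodule.smul_mem _ _ hx

theorem annihilationExponent_mem (m : ℤ) (n : ℕ) {N : ℤ} {p : YPoly} (hp : p ∈ weightLE N) :
    PowerSeries.coeff n (annihilationExponent m) p ∈ weightLE (N - n) := by
  rw [annihilationExponent, PowerSeries.coeff_mk]
  by_cases h : 0 < n
  · rw [dif_pos h]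
    exact Submodule.smul_mem _ _ (pderiv_mem_weightLE ⟨n, h⟩ hp)
  · rw [dif_neg h]
    exact zero_mem _

theorem annihilationExponent_pow_mem (m : ℤ) (k : ℕ) : ∀ (n : ℕ) {N : ℤ} {p : YPoly},
    p ∈ weightLE N →
      PowerSeries.coeff n (annihilationExponent m ^ k) p ∈ weightLE (N - n) := by
  induction k with
  | zero =>
    intro n N p hp
    rw [pow_zero, PowerSeries.coeff_one]
    split_ifs with h
    · simpa [h] using hp
    · simp
  | succ k ih =>
    intro n N p hp
    rw [pow_succ, PowerSeries.coeff_mul, LinearMap.sum_apply]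
    refine Submodule.sum_mem _ fun x hx => ?_
    have h := ih x.1 (annihilationExponent_mem m x.2 hp)
    replace hx : x.1 + x.2 = n := by simpa using hx
    have h2 : N - (x.2 : ℤ) - (x.1 : ℤ) = N - n := by rw [← hx]; push_cast; ring
    rw [h2] at h
    exact h

theorem annihilationCoeff_bdd (m : ℤ) (p : YPoly) :
    ∃ B : ℕ, ∀ b ≥ B, annihilationCoeff m b p = 0 := by
  obtain ⟨N, hN⟩ := exists_weightLE p
  refine ⟨(N + 1).toNat, fun b hb => ?_⟩
  have h : annihilationCoeff m b p ∈ weightLE (N - b) := by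
    rw [annihilationCoeff, expSeries, PowerSeries.coeff_mk, LinearMap.sum_apply]
    exact Submodule.sum_mem _ fun k _ =>
      Submodule.smul_mem _ _ (annihilationExponent_pow_mem m k b hN)
  rw [weightLE_neg (by omega)] at h
  simpa using h

/-- The `z ^ k` coefficient of the product of the two exponentials in `V_m(z)`:
the sum over `b` of the `z ^ (k + b)` coefficient of the first one, composed with the `z ^ (-b)`
coefficient of the second one. -/
def vertexCoeff (m k : ℤ) : Module.End ℂ YPoly :=
  locSum (fun b : ℕ => creationCoeff m (k + b) * annihilationCoeff m b) fun p => by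
    obtain ⟨B, hB⟩ := annihilationCoeff_bdd m p
    refine (Set.finite_lt_nat B).subset fun b hb => ?_
    by_contra h
    exact hb (by simp [hB b (not_lt.1 h)])

theorem vertexCoeff_bdd (m : ℤ) (p : YPoly) :
    ∃ N : ℤ, ∀ k < N, vertexCoeff m k p = 0 := by
  obtain ⟨B, hB⟩ := annihilationCoeff_bdd m p
  refine ⟨-B, fun k hk => ?_⟩
  rw [vertexCoeff, locSum_apply]
  refine (finsum_congr fun b => ?_).trans finsum_zero
  rcases lt_or_ge b B with h | h
  · rw [creationCoeff, if_neg (by omega), zero_mul, LinearMap.zero_apply]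
  · simp [hB b h]

/-- `V_m(z) = exp (m ∑_{n>0} y_{nℓ} zⁿ) e^{m y₀} exp (- m ∑_{n>0} (1/n) (∂/∂y*_{nℓ}) z⁻ⁿ)`,
where `e^{m y₀}` is the multiplication by `T m` on the second factor of `F_𝔡`. -/
def V (m : ℤ) : VertexOperator ℂ FD :=
  VertexOperator.of_coeff
    (fun k => TensorProduct.map (vertexCoeff m k)
      (LinearMap.mulLeft ℂ (LaurentPolynomial.T m : ℂ[T;T⁻¹]))) fun f => by
    induction f using TensorProduct.induction_on with
    | zero => simp
    | tmul p q =>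
      obtain ⟨N, hN⟩ := vertexCoeff_bdd m p
      refine bddBelow_of_forall N fun k hk => ?_
      rw [TensorProduct.map_tmul, hN k hk, TensorProduct.zero_tmul]
    | add x y hx hy =>
      refine (hx.union hy).mono ?_
      simp only [map_add]
      exact Function.support_add _ _

/-! ### Free fermions and the fermionic Fock space

A half-integer `i ∈ ℤ + 1/2` is encoded by the integer `k = i - 1/2`. Thus `i > 0` means `0 ≤ k`,
the negative `-i` is encoded by `-k - 1`, and `i + j = 0` means `k + l + 1 = 0`. -/

/-- Generators: `Sum.inl k` is `ψ_{k+1/2}` and `Sum.inr k` is `ψ*_{k+1/2}`. -/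
abbrev FreeFermion : Type := FreeAlgebra ℂ (ℤ ⊕ ℤ)

inductive FermionRel : FreeFermion → FreeFermion → Prop
  | psi_psi (k l : ℤ) : FermionRel
      (FreeAlgebra.ι ℂ (Sum.inl k) * FreeAlgebra.ι ℂ (Sum.inl l)
        + FreeAlgebra.ι ℂ (Sum.inl l) * FreeAlgebra.ι ℂ (Sum.inl k)) 0
  | star_star (k l : ℤ) : FermionRel
      (FreeAlgebra.ι ℂ (Sum.inr k) * FreeAlgebra.ι ℂ (Sum.inr l)
        + FreeAlgebra.ι ℂ (Sum.inr l) * FreeAlgebra.ι ℂ (Sum.inr k)) 0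
  | star_psi (k l : ℤ) : FermionRel
      (FreeAlgebra.ι ℂ (Sum.inr k) * FreeAlgebra.ι ℂ (Sum.inl l)
        + FreeAlgebra.ι ℂ (Sum.inl l) * FreeAlgebra.ι ℂ (Sum.inr k))
      (if k + l + 1 = 0 then 1 else 0)

/-- The algebra `𝒜` of free fermions. -/
def FermionAlg : Type := RingQuot FermionRel

instance : Ring FermionAlg := inferInstanceAs (Ring (RingQuot FermionRel))

instance : Algebra ℂ FermionAlg := inferInstanceAs (Algebra ℂ (RingQuot FermionRel))

/-- The canonical projection onto `𝒜`. -/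
def toFermionAlg : FreeFermion →ₐ[ℂ] FermionAlg := RingQuot.mkAlgHom ℂ FermionRel

/-- The generator `ψ_{k+1/2}` (for `Sum.inl k`) or `ψ*_{k+1/2}` (for `Sum.inr k`) of `𝒜`. -/
def gen (x : ℤ ⊕ ℤ) : FermionAlg := toFermionAlg (FreeAlgebra.ι ℂ x)

/-- The left ideal of `𝒜` generated by all `ψ_i`, `ψ*_i` with `i > 0`. -/
def vacuumIdeal : Ideal FermionAlg :=
  Ideal.span {a | ∃ k : ℤ, 0 ≤ k ∧ (a = gen (Sum.inl k) ∨ a = gen (Sum.inr k))}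

/-- The fermionic Fock space `F_𝒜 = 𝒜 vac`, the left `𝒜`-module generated by a vector `vac`
subject to the relations `ψ_i vac = ψ*_i vac = 0` for `i > 0`. -/
def FA : Type := FermionAlg ⧸ vacuumIdeal

instance : AddCommGroup FA := inferInstanceAs (AddCommGroup (FermionAlg ⧸ vacuumIdeal))

instance : Module FermionAlg FA := inferInstanceAs (Module FermionAlg (FermionAlg ⧸ vacuumIdeal))

instance : Module ℂ FA := inferInstanceAs (Module ℂ (FermionAlg ⧸ vacuumIdeal))

instance : IsScalarTower ℂ FermionAlg FA :=
  inferInstanceAs (IsScalarTower ℂ FermionAlg (FermionAlg ⧸ vacuumIdeal))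

/-- The vacuum vector of `F_𝒜`. -/
def vacA : FA := vacuumIdeal.mkQ 1

/-- The action of `𝒜` on `F_𝒜`. -/
def act : FermionAlg →ₐ[ℂ] Module.End ℂ FA := Algebra.lsmul ℂ ℂ FA

/-- The operator `ψ_{k+1/2}` on `F_𝒜`. -/
def psi (k : ℤ) : Module.End ℂ FA := act (gen (Sum.inl k))

/-- The operator `ψ*_{k+1/2}` on `F_𝒜`. -/
def psiStar (k : ℤ) : Module.End ℂ FA := act (gen (Sum.inr k))

theorem gen_rel {x y : ℤ ⊕ ℤ} {a : FreeFermion}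
    (h : FermionRel (FreeAlgebra.ι ℂ x * FreeAlgebra.ι ℂ y
      + FreeAlgebra.ι ℂ y * FreeAlgebra.ι ℂ x) a) :
    gen x * gen y + gen y * gen x = toFermionAlg a := by
  have := RingQuot.mkAlgHom_rel ℂ h
  change toFermionAlg _ = toFermionAlg _ at this
  simpa [gen] using this

/-- A given generator anticommutes with all `ψ_k`, `ψ*_k` with `k` large. -/
theorem gen_anticomm (y : ℤ ⊕ ℤ) : ∃ M : ℤ, ∀ k ≥ M,
    gen (Sum.inl k) * gen y = -(gen y * gen (Sum.inl k)) ∧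
    gen (Sum.inr k) * gen y = -(gen y * gen (Sum.inr k)) := by
  rcases y with l | l
  · refine ⟨-l, fun k hk => ⟨?_, ?_⟩⟩
    · rw [eq_neg_iff_add_eq_zero, gen_rel (FermionRel.psi_psi k l), map_zero]
    · rw [eq_neg_iff_add_eq_zero, gen_rel (FermionRel.star_psi k l), if_neg (by omega), map_zero]
  · refine ⟨-l, fun k hk => ⟨?_, ?_⟩⟩
    · rw [eq_neg_iff_add_eq_zero, add_comm, gen_rel (FermionRel.star_psi l k),
        if_neg (by omega), map_zero]
    · rw [eq_neg_iff_add_eq_zero, gen_rel (FermionRel.star_star k l), map_zero]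

/-- Every vector of `F_𝒜` is killed by all `ψ_k`, `ψ*_k` with `k` large. -/
theorem fermion_bdd (v : FA) : ∃ N : ℤ, ∀ k ≥ N, psi k v = 0 ∧ psiStar k v = 0 := by
  have hadd : ∀ v w : FA, (∃ N : ℤ, ∀ k ≥ N, psi k v = 0 ∧ psiStar k v = 0) →
      (∃ N : ℤ, ∀ k ≥ N, psi k w = 0 ∧ psiStar k w = 0) →
      ∃ N : ℤ, ∀ k ≥ N, psi k (v + w) = 0 ∧ psiStar k (v + w) = 0 := by
    rintro v w ⟨N, hN⟩ ⟨M, hM⟩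
    refine ⟨max N M, fun k hk => ?_⟩
    obtain ⟨h1, h2⟩ := hN k ((le_max_left _ _).trans hk)
    obtain ⟨h3, h4⟩ := hM k ((le_max_right _ _).trans hk)
    simp [h1, h2, h3, h4]
  have main : ∀ (a : FreeFermion) (v : FA), (∃ N : ℤ, ∀ k ≥ N, psi k v = 0 ∧ psiStar k v = 0) →
      ∃ N : ℤ, ∀ k ≥ N, psi k (act (toFermionAlg a) v) = 0 ∧
        psiStar k (act (toFermionAlg a) v) = 0 := by
    intro a
    induction a using FreeAlgebra.induction with
    | grade0 r =>
      rintro v ⟨N, hN⟩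
      refine ⟨N, fun k hk => ?_⟩
      simp [(hN k hk).1, (hN k hk).2, AlgHom.commutes, Module.algebraMap_end_apply]
    | grade1 x =>
      rintro v ⟨N, hN⟩
      obtain ⟨M, hM⟩ := gen_anticomm x
      refine ⟨max N M, fun k hk => ?_⟩
      obtain ⟨h1, h2⟩ := hN k ((le_max_left _ _).trans hk)
      obtain ⟨h3, h4⟩ := hM k ((le_max_right _ _).trans hk)
      change (act (gen (Sum.inl k)) * act (gen x)) v = 0 ∧
        (act (gen (Sum.inr k)) * act (gen x)) v = 0
      rw [← map_mul, ← map_mul, h3, h4, map_neg, map_neg, map_mul, map_mul]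
      change -(act (gen x) (psi k v)) = 0 ∧ -(act (gen x) (psiStar k v)) = 0
      simp [h1, h2]
    | mul a b ha hb =>
      intro v hv
      simpa using ha _ (hb v hv)
    | add a b ha hb =>
      intro v hv
      simpa using hadd _ _ (ha v hv) (hb v hv)
  obtain ⟨a, rfl⟩ := vacuumIdeal.mkQ_surjective v
  obtain ⟨a, rfl⟩ := RingQuot.mkAlgHom_surjective ℂ FermionRel a
  have hvac : ∃ N : ℤ, ∀ k ≥ N, psi k vacA = 0 ∧ psiStar k vacA = 0 := by
    have hz : ∀ x : ℤ ⊕ ℤ, gen x ∈ vacuumIdeal → act (gen x) vacA = 0 := by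
      intro x hx
      change gen x • vacuumIdeal.mkQ 1 = 0
      rw [← map_smul, smul_eq_mul, mul_one]
      exact (Submodule.Quotient.mk_eq_zero _).2 hx
    exact ⟨0, fun k hk => ⟨hz _ (Ideal.subset_span ⟨k, hk, Or.inl rfl⟩),
      hz _ (Ideal.subset_span ⟨k, hk, Or.inr rfl⟩)⟩⟩
  have h := main a vacA hvac
  have e : act (toFermionAlg a) vacA = vacuumIdeal.mkQ (toFermionAlg a) := by
    change toFermionAlg a • vacuumIdeal.mkQ 1 = _
    rw [← map_smul, smul_eq_mul, mul_one]
  rw [e] at h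
  exact h

/-- `ψ(λ) = ∑_i ψ_i λ^{-i-1/2}`. -/
def psiField : VertexOperator ℂ FA :=
  VertexOperator.of_coeff (fun c => psi (-c - 1)) fun v => by
    obtain ⟨N, hN⟩ := fermion_bdd v
    exact bddBelow_of_forall (-N) fun k hk => (hN _ (by omega)).1

/-- `ψ*(λ) = ∑_i ψ*_i λ^{-i-1/2}`. -/
def psiStarField : VertexOperator ℂ FA :=
  VertexOperator.of_coeff (fun c => psiStar (-c - 1)) fun v => by
    obtain ⟨N, hN⟩ := fermion_bdd v
    exact bddBelow_of_forall (-N) fun k hk => (hN _ (by omega)).2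

/-! ### The representation of infinite matrices and its `ℓ`-reduction -/

/-- The normally ordered product `:ψ_i ψ*_j:`: it is `ψ_i ψ*_j` if `i < 0` or `j > 0`, and
`- ψ*_j ψ_i` otherwise. -/
def normalOrder (k l : ℤ) : Module.End ℂ FA :=
  if k < 0 ∨ 0 ≤ l then psi k * psiStar l else -(psiStar l * psi k)

/-- The matrices `(a_{ij})`, `i, j ∈ ℤ + 1/2`, with `a_{ij} = 0` for `|i - j| ≫ 0`. -/
def bandedMatrix : Submodule ℂ (Matrix ℤ ℤ ℂ) where
  carrier := {a | ∃ B : ℤ, ∀ i j, B < |i - j| → a i j = 0}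
  zero_mem' := ⟨0, fun _ _ _ => rfl⟩
  add_mem' := by
    rintro a b ⟨B, hB⟩ ⟨C, hC⟩
    refine ⟨max B C, fun i j h => ?_⟩
    simp [hB i j ((le_max_left _ _).trans_lt h), hC i j ((le_max_right _ _).trans_lt h)]
  smul_mem' := by
    rintro c a ⟨B, hB⟩
    exact ⟨B, fun i j h => by simp [hB i j h]⟩

theorem normalOrder_eq_zero {v : FA} {N : ℤ} (hN : ∀ k ≥ N, psi k v = 0 ∧ psiStar k v = 0)
    {k l : ℤ} (h : max N 0 ≤ l ∨ max N 0 ≤ k) : normalOrder k l v = 0 := by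
  rw [normalOrder]
  rcases h with h | h
  · rw [if_pos (Or.inr ((le_max_right _ _).trans h)), Module.End.mul_apply,
      (hN l ((le_max_left _ _).trans h)).2, map_zero]
  · have hk := (le_max_right N 0).trans h
    have h0 : (psiStar l * psi k) v = 0 := by
      rw [Module.End.mul_apply, (hN k ((le_max_left _ _).trans h)).1, map_zero]
    split_ifs with hl
    · have e : psi k * psiStar l = -(psiStar l * psi k) := by
        rw [eq_neg_iff_add_eq_zero, add_comm]
        change act _ * act _ + act _ * act _ = 0
        rw [← map_mul, ← map_mul, ← map_add, gen_rel (FermionRel.star_psi l k),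
          if_neg (by omega), map_zero, map_zero]
      rw [e, LinearMap.neg_apply, h0, neg_zero]
    · rw [LinearMap.neg_apply, h0, neg_zero]

theorem piInf_support_finite (a : bandedMatrix) (v : FA) : (Function.support fun p : ℤ × ℤ =>
    (a.1 p.1 p.2 • normalOrder (-p.1 - 1) p.2 : Module.End ℂ FA) v).Finite := by
  obtain ⟨N, hN⟩ := fermion_bdd v
  obtain ⟨a, B, hB⟩ := a
  set K := |N| + |B| + 2
  refine ((Set.finite_Icc (-K) K).prod (Set.finite_Icc (-2 * K) (2 * K))).subset ?_
  rintro ⟨i, j⟩ hp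
  have h1 : |i - j| ≤ B := not_lt.1 fun h => hp (by
    change (a i j • normalOrder (-i - 1) j) v = 0
    rw [hB i j h, zero_smul, LinearMap.zero_apply])
  have h2 : ¬ (max N 0 ≤ j ∨ max N 0 ≤ -i - 1) := fun h => hp (by
    change (a i j • normalOrder (-i - 1) j) v = 0
    rw [LinearMap.smul_apply, normalOrder_eq_zero hN h, smul_zero])
  have h3 := le_abs_self N
  have h4 := le_abs_self B
  have h5 := abs_nonneg N
  rw [abs_le] at h1
  simp only [Set.mem_prod, Set.mem_Icc]
  have hK : K = |N| + |B| + 2 := rfl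
  push Not at h2
  obtain ⟨h6, h7⟩ := h2
  rcases max_cases N 0 with ⟨hm, _⟩ | ⟨hm, _⟩ <;> rw [hm] at h6 h7 <;> omega

/-- The action `π_∞ : E_{ij} ↦ :ψ_{-i} ψ*_j:` on `F_𝒜`. -/
def piInf : bandedMatrix →ₗ[ℂ] Module.End ℂ FA where
  toFun a := locSum (fun p : ℤ × ℤ => a.1 p.1 p.2 • normalOrder (-p.1 - 1) p.2)
    (piInf_support_finite a)
  map_add' a b := by
    refine LinearMap.ext fun v => ?_
    refine Eq.trans (finsum_congr fun p => ?_)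
      (finsum_add_distrib (piInf_support_finite a v) (piInf_support_finite b v))
    exact congrArg (fun L : Module.End ℂ FA => L v) (add_smul (a.1 p.1 p.2) (b.1 p.1 p.2) _)
  map_smul' c a := by
    refine LinearMap.ext fun v => ?_
    refine Eq.trans (finsum_congr fun p => ?_) (smul_finsum c _).symm
    exact congrArg (fun L : Module.End ℂ FA => L v) (mul_smul c (a.1 p.1 p.2) _)

variable (ℓ : ℕ) [NeZero ℓ]

/-- The special linear Lie algebra `𝔰𝔩_ℓ(ℂ)`. -/
abbrev SlAlg : Type := LieAlgebra.SpecialLinear.sl (Fin ℓ) ℂ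

/-- The `ℓ`-periodic infinite matrix with all its `ℓ × ℓ` blocks in position `(r, r + n)` equal
to `X`, all other blocks being zero. -/
def blockMatrix (n : ℤ) (X : Matrix (Fin ℓ) (Fin ℓ) ℂ) : Matrix ℤ ℤ ℂ :=
  Matrix.of fun i j => if (Int.divModEquiv ℓ j).1 = (Int.divModEquiv ℓ i).1 + n then
    X (Int.divModEquiv ℓ i).2 (Int.divModEquiv ℓ j).2 else 0

theorem blockMatrix_of_ne {n : ℤ} (X : Matrix (Fin ℓ) (Fin ℓ) ℂ) {i j : ℤ}
    (h : j / (ℓ : ℤ) ≠ i / (ℓ : ℤ) + n) : blockMatrix ℓ n X i j = 0 :=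
  if_neg h

/-- The matrix `ι_ℓ(X sⁿ)`. -/
def iotaMatrix (n : ℤ) : SlAlg ℓ →ₗ[ℂ] bandedMatrix where
  toFun X := ⟨blockMatrix ℓ n X.1, ℓ * (|n| + 1), fun i j h => by
    refine blockMatrix_of_ne ℓ _ fun h' => ?_
    have hℓ : (0 : ℤ) < ℓ := by exact_mod_cast Nat.pos_of_neZero ℓ
    have e1 := Int.mul_ediv_add_emod i ℓ
    have e2 := Int.mul_ediv_add_emod j ℓ
    have e3 := Int.emod_nonneg i hℓ.ne'
    have e4 := Int.emod_nonneg j hℓ.ne'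
    have e5 := Int.emod_lt_of_pos i hℓ
    have e6 := Int.emod_lt_of_pos j hℓ
    have e7 : (ℓ : ℤ) * n ≤ ℓ * |n| := mul_le_mul_of_nonneg_left (le_abs_self n) hℓ.le
    have e8 : (ℓ : ℤ) * (-|n|) ≤ ℓ * n := mul_le_mul_of_nonneg_left (neg_abs_le n) hℓ.le
    rw [h', mul_add] at e2
    refine absurd h (not_lt.2 (abs_le.2 ⟨?_, ?_⟩)) <;> nlinarith⟩
  map_add' X Y := by
    refine Subtype.ext (Matrix.ext fun i j => ?_)
    change blockMatrix ℓ n (X.1 + Y.1) i j = blockMatrix ℓ n X.1 i j + blockMatrix ℓ n Y.1 i j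
    simp only [blockMatrix, Matrix.of_apply, Matrix.add_apply]
    split_ifs <;> simp
  map_smul' c X := by
    refine Subtype.ext (Matrix.ext fun i j => ?_)
    change blockMatrix ℓ n (c • X.1) i j = c • blockMatrix ℓ n X.1 i j
    simp only [blockMatrix, Matrix.of_apply, Matrix.smul_apply]
    split_ifs <;> simp

/-- The action of `X sⁿ` on `F_𝒜`. -/
def currentMode (n : ℤ) : SlAlg ℓ →ₗ[ℂ] Module.End ℂ FA := piInf ∘ₗ iotaMatrix ℓ n

theorem currentMode_bdd (X : SlAlg ℓ) (v : FA) : ∃ N : ℤ, ∀ n ≥ N, currentMode ℓ n X v = 0 := by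
  obtain ⟨N, hN⟩ := fermion_bdd v
  refine ⟨2 * |N| + 4, fun n hn => (finsum_congr fun p => ?_).trans finsum_zero⟩
  obtain ⟨i, j⟩ := p
  change (blockMatrix ℓ n X.1 i j • normalOrder (-i - 1) j) v = 0
  by_cases h : j / (ℓ : ℤ) = i / (ℓ : ℤ) + n
  · rw [LinearMap.smul_apply, normalOrder_eq_zero hN, smul_zero]
    have hℓ : (0 : ℤ) < ℓ := by exact_mod_cast Nat.pos_of_neZero ℓ
    have e1 := Int.mul_ediv_add_emod i ℓ
    have e2 := Int.mul_ediv_add_emod j ℓ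
    have e4 := Int.emod_nonneg j hℓ.ne'
    have e5 := Int.emod_lt_of_pos i hℓ
    have h5 := abs_nonneg N
    have hmax : max N 0 ≤ |N| := max_le (le_abs_self N) h5
    by_cases hj : |N| + 1 ≤ j / (ℓ : ℤ)
    · left
      nlinarith
    · right
      have hi : i / (ℓ : ℤ) ≤ -|N| - 3 := by linarith
      nlinarith
  · rw [blockMatrix_of_ne ℓ _ h, zero_smul, LinearMap.zero_apply]

/-- `X^π(z) = ∑_n π(X sⁿ) z^{-n-1}`. -/
def currentField : SlAlg ℓ →ₗ[ℂ] VertexOperator ℂ FA where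
  toFun X := VertexOperator.of_coeff (fun c => currentMode ℓ (-c - 1) X) fun v => by
    obtain ⟨N, hN⟩ := currentMode_bdd ℓ X v
    exact bddBelow_of_forall (-N) fun k hk => hN _ (by omega)
  map_add' X Y := by
    refine HVertexOperator.coeff_inj (funext fun c => ?_)
    exact map_add (currentMode ℓ (-c - 1)) X Y
  map_smul' a X := by
    refine HVertexOperator.coeff_inj (funext fun c => ?_)
    exact map_smul (currentMode ℓ (-c - 1)) a X

/-! ### The action of `𝔰𝔩_ℓ ⊗ ℂ[s^{±1}, t^{±1}]` and the group `SL_ℓ^tor` -/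

/-- `F_𝒜^tor = F_𝒜 ⊗ F_𝔡`. -/
abbrev FTor : Type := FA ⊗[ℂ] FD

/-- `vac_𝒜 ⊗ vac_𝔡`. -/
def vacTor : FTor := vacA ⊗ₜ[ℂ] vacD

/-- The Laurent polynomial ring `R = ℂ[s^{±1}, t^{±1}]`; the monomial `sⁿ tᵐ` is
`AddMonoidAlgebra.single (n, m) 1`. -/
abbrev LaurentST : Type := AddMonoidAlgebra ℂ (ℤ × ℤ)

/-- The action of `X sⁿ tᵐ` on `F_𝒜^tor`: the coefficient of `z^{-n-1}` in `X^π(z) V_m(z)`. -/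
def torMode (n m : ℤ) : SlAlg ℓ →ₗ[ℂ] Module.End ℂ FTor where
  toFun X := HVertexOperator.coeff (tensorField (currentField ℓ X) (V m)) (-n - 1)
  map_add' X Y := by
    refine LinearMap.ext fun u => ?_
    refine Eq.trans (finsum_congr fun a => ?_)
      (finsum_add_distrib (tensor_support_finite (currentField ℓ X) (V m) (-n - 1) u)
        (tensor_support_finite (currentField ℓ Y) (V m) (-n - 1) u))
    simp only [map_add, Pi.add_apply]
    rw [TensorProduct.map_add_left, LinearMap.add_apply]
  map_smul' c X := by
    refine LinearMap.ext fun u => ?_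
    refine Eq.trans (finsum_congr fun a => ?_) (smul_finsum c _).symm
    simp only [map_smul, Pi.smul_apply]
    rw [TensorProduct.map_smul_left, LinearMap.smul_apply]

/-- The restriction to `𝔰𝔩_ℓ ⊗ R` of the representation of the toroidal Lie algebra on
`F_𝒜^tor`. -/
def torAction : (SlAlg ℓ ⊗[ℂ] LaurentST) →ₗ[ℂ] Module.End ℂ FTor :=
  TensorProduct.lift
    (((Finsupp.linearCombination ℂ fun p : ℤ × ℤ => torMode ℓ p.1 p.2) ∘ₗ
      (AddMonoidAlgebra.coeffLinearEquiv ℂ).toLinearMap).flip)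

/-- Local nilpotency of a linear operator. -/
def LocallyNilpotent {M : Type*} [AddCommGroup M] [Module ℂ M] (A : Module.End ℂ M) : Prop :=
  ∀ v, ∃ N : ℕ, (A ^ N) v = 0

/-- The exponential series `∑ A^k v / k!`, a finite sum if `A` is locally nilpotent. -/
def expApply {M : Type*} [AddCommGroup M] [Module ℂ M] (A : Module.End ℂ M) (v : M) : M :=
  ∑ᶠ k : ℕ, ((k.factorial : ℂ)⁻¹) • (A ^ k) v

/-- The group `SL_ℓ^tor` of invertible linear transformations of `F_𝒜^tor` generated by the
exponentials of the elements of `𝔰𝔩_ℓ ⊗ R` that act locally nilpotently. -/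
def SLTor : Subgroup (FTor ≃ₗ[ℂ] FTor) :=
  Subgroup.closure {g | ∃ x : SlAlg ℓ ⊗[ℂ] LaurentST,
    LocallyNilpotent (torAction ℓ x) ∧ ∀ v, g v = expApply (torAction ℓ x) v}

/-! ### The operator `Ω_𝒜^tor(λ)` -/

/-- The `m`-th term `ψ(λ) V_m(λ^ℓ) ⊗ ψ*(λ) V_{-m}(λ^ℓ)`. -/
def omegaTerm (m : ℤ) : VertexOperator ℂ (FTor ⊗[ℂ] FTor) :=
  tensorField (tensorField psiField (substPow ℓ (V m)))
    (tensorField psiStarField (substPow ℓ (V (-m))))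

/-- The coefficient of `e^{a y₀}` of an element of `F_𝒜^tor`. -/
def chargeCoeff (a : ℤ) : FTor →ₗ[ℂ] FA ⊗[ℂ] YPoly :=
  LinearMap.lTensor FA ((TensorProduct.rid ℂ YPoly).toLinearMap ∘ₗ
    LinearMap.lTensor YPoly (Finsupp.lapply a ∘ₗ
      (AddMonoidAlgebra.coeffLinearEquiv (R := ℂ) (S := ℂ) (M := ℤ)).toLinearMap))

/-- The formal completion of `F_𝒜^tor ⊗ F_𝒜^tor` consisting of all, possibly infinite, sums
`∑_{a, b} u_{a,b} (e^{a y₀} ⊗ e^{b y₀})`, given by their coefficients `u_{a,b}`. -/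
abbrev FTor2Hat : Type := ℤ × ℤ → (FA ⊗[ℂ] YPoly) ⊗[ℂ] (FA ⊗[ℂ] YPoly)

/-- The coefficient of `e^{a y₀} ⊗ e^{b y₀}` of an element of `F_𝒜^tor ⊗ F_𝒜^tor`. -/
def chargeCoeff2 (p : ℤ × ℤ) :
    FTor ⊗[ℂ] FTor →ₗ[ℂ] (FA ⊗[ℂ] YPoly) ⊗[ℂ] (FA ⊗[ℂ] YPoly) :=
  TensorProduct.map (chargeCoeff p.1) (chargeCoeff p.2)

theorem chargeCoeff_support_finite (v : FTor) :
    (Function.support fun a => chargeCoeff a v).Finite := by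
  induction v using TensorProduct.induction_on with
  | zero => simp
  | tmul f g =>
    induction g using TensorProduct.induction_on with
    | zero => simp
    | tmul p q =>
      refine q.coeff.support.finite_toSet.subset fun a ha => ?_
      rw [Finset.mem_coe, Finsupp.mem_support_iff]
      intro h
      refine ha ?_
      change f ⊗ₜ[ℂ] (q.coeff a • p) = 0
      rw [h, zero_smul, TensorProduct.tmul_zero]
    | add x y hx hy =>
      refine (hx.union hy).subset ?_
      simp only [TensorProduct.tmul_add, map_add]
      exact Function.support_add _ _
  | add x y hx hy =>
    refine (hx.union hy).subset ?_
    simp only [map_add]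
    exact Function.support_add _ _

theorem chargeCoeff_map (a m : ℤ) (A : Module.End ℂ FA) (B : Module.End ℂ YPoly) (v : FTor) :
    chargeCoeff a (TensorProduct.map A
      (TensorProduct.map B (LinearMap.mulLeft ℂ (LaurentPolynomial.T m : ℂ[T;T⁻¹]))) v)
      = TensorProduct.map A B (chargeCoeff (a - m) v) := by
  induction v using TensorProduct.induction_on with
  | zero => simp
  | tmul f g =>
    induction g using TensorProduct.induction_on with
    | zero => simp
    | tmul p q =>
      change A f ⊗ₜ[ℂ] ((LaurentPolynomial.T m * q).coeff a • B p)
        = A f ⊗ₜ[ℂ] B (q.coeff (a - m) • p)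
      have h : (LaurentPolynomial.T m * q).coeff a = q.coeff (a - m) := by
        rw [LaurentPolynomial.T, AddMonoidAlgebra.coeff_single_mul_eq_mul_coeff (a - m)
          fun k _ => ⟨fun h => by linarith, fun h => by linarith⟩, one_mul]
      rw [h, map_smul]
    | add x y hx hy => simp only [TensorProduct.tmul_add, map_add, hx, hy]
  | add x y hx hy => simp only [map_add, hx, hy]

theorem chargeCoeff_eq_zero (A : VertexOperator ℂ FA) (a m k : ℤ) (v : FTor)
    (h : chargeCoeff (a - m) v = 0) :
    chargeCoeff a (HVertexOperator.coeff (tensorField A (substPow ℓ (V m))) k v) = 0 := by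
  refine (map_locSum (chargeCoeff a) _ (tensor_support_finite A (substPow ℓ (V m)) k) v).trans ((finsum_congr fun i => ?_).trans finsum_zero)
  change chargeCoeff a (TensorProduct.map (HVertexOperator.coeff A i)
    (if (ℓ : ℤ) ∣ k - i then HVertexOperator.coeff (V m) ((k - i) / ℓ) else 0) v) = 0
  split_ifs
  · exact (chargeCoeff_map a m _ _ v).trans (by rw [h, map_zero])
  · rw [TensorProduct.map_zero_right, LinearMap.zero_apply, map_zero]

theorem omega_support_finite (c : ℤ) (p : ℤ × ℤ) (u : FTor ⊗[ℂ] FTor) :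
    (Function.support fun m : ℤ =>
      (chargeCoeff2 p ∘ₗ HVertexOperator.coeff (omegaTerm ℓ m) c) u).Finite := by
  induction u using TensorProduct.induction_on with
  | zero => simp
  | tmul v w =>
    refine ((chargeCoeff_support_finite v).preimage
      (sub_right_injective (b := p.1)).injOn).subset fun m hm => ?_
    intro h
    refine hm ?_
    refine (map_locSum (chargeCoeff2 p) _ (tensor_support_finite _ _ c) _).trans
      ((finsum_congr fun i => ?_).trans finsum_zero)
    rw [TensorProduct.map_tmul, chargeCoeff2, TensorProduct.map_tmul,
      chargeCoeff_eq_zero ℓ _ _ _ _ _ h, TensorProduct.zero_tmul]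
  | add x y hx hy =>
    refine (hx.union hy).subset ?_
    simp only [map_add]
    exact Function.support_add _ _

/-- The `λ ^ c` coefficient of
`Ω_𝒜^tor(λ) = ∑_{m ∈ ℤ} ψ(λ) V_m(λ^ℓ) ⊗ ψ*(λ) V_{-m}(λ^ℓ)`. Only finitely many `m` contribute to
a given coefficient `e^{a y₀} ⊗ e^{b y₀}` of the result. -/
def omegaTor (c : ℤ) : FTor ⊗[ℂ] FTor →ₗ[ℂ] FTor2Hat :=
  LinearMap.pi fun p => locSum (fun m : ℤ =>
    chargeCoeff2 p ∘ₗ HVertexOperator.coeff (omegaTerm ℓ m) c) (omega_support_finite ℓ c p)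

/-- The formal contour integral `∮ λ^N f(λ) dλ` (up to the factor `2πi`) of the formal
distribution `f(λ) = ∑_c f_c λ^c`: the coefficient of `λ⁻¹` in `λ^N f(λ)`. -/
def contourIntegral {M : Type*} (N : ℤ) (f : ℤ → M) : M := f (-1 - N)

end Toroidal

end

open scoped TensorProduct LaurentPolynomial

noncomputable section

namespace Toroidal

/-! For fixed `j`, the coefficient of `λ^{-1-jℓ}` in `Ω` has a kernel `K`. The vacuum square lies in
`K`, and `K` is stable under `g ⊗ g` for every `g` in the group.

Stability is first proved infinitesimally. Bracketing `X sⁿ` with the fermions mixes the `ℓ` modes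
of a block through `X` and shifts the block by `n`. The modes of `ψ` transform by `X` and those of
`ψ*` by minus its transpose, so the pairing of complete blocks in the coefficient of `λ^{-1-jℓ}` is
invariant. The bosonic factors are harmless: `V_m` involves only the `y` and the derivatives in
`y*`, so all modes commute and `V_m(z) V_k(z) = V_{m+k}(z)`. Hence `X sⁿ tᵐ` on the first leg of the
`k`-th term of `Ω` and on the second leg of the `(m+k)`-th term both produce the charges `(m+k,
-k)`, with opposite signs (`omegaTerm_commutator`). Summing over `k`, separately for each power of
`e^{y₀}`, shows that `A ⊗ 1 + 1 ⊗ A` preserves `K` for every `A` in the image of `𝔰𝔩_ℓ ⊗ R`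
(`omegaTor_diagonal_torMode`, `torAction_mem_diagonalStabilizer`).

For locally nilpotent `A` one has `exp A ⊗ exp A = exp (A ⊗ 1 + 1 ⊗ A)` (`expApply_tmul`), which
gives stability under the generators. Their inverses are the exponentials of `-A`. On the vacuum all
four fields have only nonnegative powers of `λ`, while `-1 - jℓ < 0` when `j ≥ 0`. -/

theorem support_map_finite {ι M N : Type*} [AddCommGroup M] [Module ℂ M] [AddCommGroup N]
    [Module ℂ N] (g : M →ₗ[ℂ] N) {f : ι → M} (hf : (Function.support f).Finite) :
    (Function.support fun i => g (f i)).Finite :=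
  hf.subset fun _ hi h => hi ((congrArg g h).trans (map_zero g))

/-! ### Exponentials of power series with noncommuting coefficients. -/

section ExpSeries

variable {E : Type*} [Ring E]

theorem coeff_pow_eq_zero {f : PowerSeries E} (hf : PowerSeries.coeff 0 f = 0) (k : ℕ) :
    ∀ n < k, PowerSeries.coeff n (f ^ k) = 0 := by
  induction k with
  | zero => intro n hn; omega
  | succ k ih =>
    intro n hn
    rw [pow_succ, PowerSeries.coeff_mul]
    refine Finset.sum_eq_zero fun x hx => ?_
    have hx' : x.1 + x.2 = n := by simpa using hx
    rcases Nat.eq_zero_or_pos x.2 with h | h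
    · rw [h, hf, mul_zero]
    · rw [ih x.1 (by omega), zero_mul]

theorem commute_coeff_pow {a : E} {f : PowerSeries E} (h : ∀ n, Commute a (PowerSeries.coeff n f))
    (k : ℕ) : ∀ n, Commute a (PowerSeries.coeff n (f ^ k)) := by
  induction k with
  | zero =>
    intro n
    rw [pow_zero, PowerSeries.coeff_one]
    split_ifs
    · exact Commute.one_right a
    · exact Commute.zero_right a
  | succ k ih =>
    intro n
    rw [pow_succ, PowerSeries.coeff_mul]
    exact Commute.sum_right _ _ _ fun x _ => (ih x.1).mul_right (h x.2)

variable [Algebra ℂ E]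

/-- Since `f ^ k` starts in degree `k`, the truncation bound may be enlarged freely. This lets
several coefficients share one bound. -/
theorem coeff_expSeries {f : PowerSeries E} (hf : PowerSeries.coeff 0 f = 0) {n N : ℕ}
    (h : n < N) : PowerSeries.coeff n (expSeries f) =
      ∑ k ∈ Finset.range N, ((k.factorial : ℂ)⁻¹) • PowerSeries.coeff n (f ^ k) := by
  rw [expSeries, PowerSeries.coeff_mk]
  refine Finset.sum_subset (Finset.range_mono h) fun k _ hk => ?_
  rw [coeff_pow_eq_zero hf k n (by simpa using hk), smul_zero]

/-- Passage from a square to a triangle of indices, legitimate because the terms beyond the diagonal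
`k + l = N - 1` vanish. It serves every Cauchy product below: exponential series, exponentials of
operators and annihilation parts. -/
theorem sum_range_mul_range_of_antidiagonal {M : Type*} [AddCommMonoid M] (F : ℕ → ℕ → M) (N : ℕ)
    (hF : ∀ k l, N ≤ k + l → F k l = 0) :
    ∑ k ∈ Finset.range N, ∑ l ∈ Finset.range N, F k l =
      ∑ n ∈ Finset.range N, ∑ x ∈ Finset.HasAntidiagonal.antidiagonal n, F x.1 x.2 := by
  rw [← Finset.sum_product', Finset.sum_sigma']
  symm
  refine Finset.sum_bij_ne_zero (fun a _ _ => a.2) ?_ ?_ ?_ ?_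
  · rintro ⟨n, a, b⟩ h1 _
    simp only [Finset.mem_sigma, Finset.mem_range, Finset.HasAntidiagonal.mem_antidiagonal,
      Finset.mem_product] at h1 ⊢
    omega
  · rintro ⟨n, a, b⟩ h1 _ ⟨n', a', b'⟩ h1' _ h
    simp only [Finset.mem_sigma, Finset.mem_range, Finset.HasAntidiagonal.mem_antidiagonal]
      at h1 h1'
    simp only [Prod.mk.injEq] at h
    obtain ⟨rfl, rfl⟩ := h
    obtain ⟨_, rfl⟩ := h1
    obtain ⟨_, rfl⟩ := h1'
    rfl
  · rintro ⟨a, b⟩ _ h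
    refine ⟨⟨a + b, a, b⟩, ?_, h, rfl⟩
    have : a + b < N := not_le.1 fun h' => h (hF a b h')
    simpa using this
  · intros; rfl

theorem inv_factorial_mul_inv_factorial (k l : ℕ) :
    ((k.factorial : ℂ)⁻¹) * (l.factorial : ℂ)⁻¹ =
      ((k + l).factorial : ℂ)⁻¹ * ((k + l).choose k : ℂ) := by
  have h1 : (k.factorial : ℂ) ≠ 0 := by exact_mod_cast k.factorial_pos.ne'
  have h2 : (l.factorial : ℂ) ≠ 0 := by exact_mod_cast l.factorial_pos.ne'
  have h3 : ((k + l).factorial : ℂ) ≠ 0 := by exact_mod_cast (k + l).factorial_pos.ne'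
  have h4 := Nat.choose_mul_factorial_mul_factorial (Nat.le_add_right k l)
  rw [Nat.add_sub_cancel_left] at h4
  have h5 : ((k + l).choose k : ℂ) * k.factorial * l.factorial = (k + l).factorial := by
    exact_mod_cast h4
  field_simp
  rw [← h5]
  ring

/-- Both exponents are scalar multiples of the same `f`, so only powers of `f` get multiplied and
the binomial theorem is needed for scalars only. No commutativity among the coefficients of `f` is
required. -/
theorem expSeries_mul_expSeries {f : PowerSeries E} (hf : PowerSeries.coeff 0 f = 0) (a b : ℂ) :
    expSeries (a • f) * expSeries (b • f) = expSeries ((a + b) • f) := by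
  have h0 : ∀ c : ℂ, PowerSeries.coeff 0 (c • f) = 0 := fun c => by
    rw [PowerSeries.coeff_smul, hf, smul_zero]
  ext n
  rw [PowerSeries.coeff_mul]
  -- Both factors are truncated at `n + 1`, independently of `x`, so that the sum over `x` can be
  -- moved inside and recombined into a coefficient of `f ^ (k + l)`.
  have e1 : ∀ x ∈ Finset.HasAntidiagonal.antidiagonal n,
      PowerSeries.coeff x.1 (expSeries (a • f)) * PowerSeries.coeff x.2 (expSeries (b • f)) =
      ∑ k ∈ Finset.range (n + 1), ∑ l ∈ Finset.range (n + 1),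
        (((k.factorial : ℂ)⁻¹ * a ^ k) * ((l.factorial : ℂ)⁻¹ * b ^ l)) •
          (PowerSeries.coeff x.1 (f ^ k) * PowerSeries.coeff x.2 (f ^ l)) := by
    intro x hx
    have hx' : x.1 + x.2 = n := by simpa using hx
    rw [coeff_expSeries (h0 a) (show x.1 < n + 1 by omega),
      coeff_expSeries (h0 b) (show x.2 < n + 1 by omega), Finset.sum_mul_sum]
    refine Finset.sum_congr rfl fun k _ => Finset.sum_congr rfl fun l _ => ?_
    rw [smul_pow, smul_pow, PowerSeries.coeff_smul, PowerSeries.coeff_smul, smul_smul, smul_smul,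
      smul_mul_smul_comm]
  rw [Finset.sum_congr rfl e1, Finset.sum_comm]
  simp_rw [Finset.sum_comm (s := Finset.HasAntidiagonal.antidiagonal n), ← Finset.smul_sum,
    ← PowerSeries.coeff_mul, ← pow_add]
  rw [sum_range_mul_range_of_antidiagonal
    (fun k l => (((k.factorial : ℂ)⁻¹ * a ^ k) * ((l.factorial : ℂ)⁻¹ * b ^ l)) •
      PowerSeries.coeff n (f ^ (k + l))) (n + 1)
    fun k l h => by rw [coeff_pow_eq_zero hf _ _ (by omega), smul_zero],
    coeff_expSeries (h0 _) (Nat.lt_succ_self n)]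
  refine Finset.sum_congr rfl fun N _ => ?_
  rw [smul_pow, PowerSeries.coeff_smul, smul_smul, (Commute.all a b).add_pow', Finset.mul_sum,
    Finset.sum_smul]
  refine Finset.sum_congr rfl fun x hx => ?_
  have hx' : x.1 + x.2 = N := by simpa using hx
  rw [hx', mul_mul_mul_comm, inv_factorial_mul_inv_factorial, hx', nsmul_eq_mul, mul_assoc]

theorem commute_coeff_expSeries {a : E} {f : PowerSeries E}
    (h : ∀ n, Commute a (PowerSeries.coeff n f)) (n : ℕ) :
    Commute a (PowerSeries.coeff n (expSeries f)) := by
  rw [expSeries, PowerSeries.coeff_mk]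
  exact Commute.sum_right _ _ _ fun k _ => (commute_coeff_pow h k n).smul_right _

theorem commute_coeff_expSeries_expSeries {f g : PowerSeries E}
    (h : ∀ i j, Commute (PowerSeries.coeff i f) (PowerSeries.coeff j g)) (i j : ℕ) :
    Commute (PowerSeries.coeff i (expSeries f)) (PowerSeries.coeff j (expSeries g)) :=
  commute_coeff_expSeries (fun n => (commute_coeff_expSeries (fun n' => (h n' n).symm) i).symm) j

end ExpSeries

/-! ### Exponentials of locally nilpotent operators. -/

section ExpApply

variable {M N : Type*} [AddCommGroup M] [Module ℂ M] [AddCommGroup N] [Module ℂ N]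

theorem pow_apply_eq_zero_of_le {A : Module.End ℂ M} {v : M} {n k : ℕ} (h : (A ^ n) v = 0)
    (hk : n ≤ k) : (A ^ k) v = 0 := by
  rw [← Nat.sub_add_cancel hk, pow_add, Module.End.mul_apply, h, map_zero]

theorem expApply_eq_sum {A : Module.End ℂ M} {v : M} {n : ℕ} (h : (A ^ n) v = 0) :
    expApply A v = ∑ k ∈ Finset.range n, ((k.factorial : ℂ)⁻¹) • (A ^ k) v := by
  refine finsum_eq_sum_of_support_subset _ fun k hk => ?_
  rw [Finset.coe_range, Set.mem_Iio]
  by_contra hk'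
  refine hk ?_
  change ((k.factorial : ℂ)⁻¹) • (A ^ k) v = 0
  rw [pow_apply_eq_zero_of_le h (not_lt.1 hk'), smul_zero]

theorem add_pow_apply_eq_zero {A B : Module.End ℂ M} (hAB : Commute A B) {v : M} {n : ℕ}
    (hA : (A ^ n) v = 0) (hB : (B ^ n) v = 0) {k l : ℕ} (h : n + n ≤ k + l) :
    (A ^ k) ((B ^ l) v) = 0 := by
  rcases le_or_gt n l with hl | hl
  · rw [pow_apply_eq_zero_of_le hB hl, map_zero]
  · rw [← Module.End.mul_apply, (hAB.pow_pow k l).eq, Module.End.mul_apply,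
      pow_apply_eq_zero_of_le hA (by omega), map_zero]

theorem add_pow_apply {A B : Module.End ℂ M} (hAB : Commute A B) (v : M) (n : ℕ) :
    ((n.factorial : ℂ)⁻¹) • ((A + B) ^ n) v = ∑ x ∈ Finset.HasAntidiagonal.antidiagonal n,
      ((x.1.factorial : ℂ)⁻¹ * (x.2.factorial : ℂ)⁻¹) • (A ^ x.1) ((B ^ x.2) v) := by
  rw [hAB.add_pow', LinearMap.sum_apply, Finset.smul_sum]
  refine Finset.sum_congr rfl fun x hx => ?_
  have hx' : x.1 + x.2 = n := by simpa using hx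
  rw [inv_factorial_mul_inv_factorial, hx', mul_smul, LinearMap.smul_apply, Module.End.mul_apply,
    Nat.cast_smul_eq_nsmul]

theorem expApply_add {A B : Module.End ℂ M} (hA : LocallyNilpotent A)
    (hB : LocallyNilpotent B) (hAB : Commute A B) (v : M) :
    expApply A (expApply B v) = expApply (A + B) v := by
  obtain ⟨n, hn⟩ := hA v
  obtain ⟨m, hm⟩ := hB v
  set N := max n m
  have h1 := pow_apply_eq_zero_of_le hn (le_max_left n m)
  have h2 := pow_apply_eq_zero_of_le hm (le_max_right n m)
  -- If `k + l ≥ 2N`, one of the exponents is at least `N`. The bound `N + N` therefore truncates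
  -- all three exponentials at once.
  have hz : ∀ k l, N + N ≤ k + l → (A ^ k) ((B ^ l) v) = 0 :=
    fun k l h => add_pow_apply_eq_zero hAB h1 h2 h
  have hs : ((A + B) ^ (N + N)) v = 0 := by
    rw [hAB.add_pow', LinearMap.sum_apply]
    refine Finset.sum_eq_zero fun x hx => ?_
    have hx' : x.1 + x.2 = N + N := by simpa using hx
    rw [LinearMap.smul_apply, Module.End.mul_apply, hz _ _ hx'.ge, smul_zero]
  have hB' : (B ^ (N + N)) v = 0 := pow_apply_eq_zero_of_le h2 (by omega)
  have hA' : (A ^ (N + N)) (expApply B v) = 0 := by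
    rw [expApply_eq_sum hB', map_sum]
    exact Finset.sum_eq_zero fun l _ => by rw [map_smul, hz _ _ (by omega), smul_zero]
  rw [expApply_eq_sum hA', expApply_eq_sum hB', expApply_eq_sum hs]
  simp_rw [add_pow_apply hAB, map_sum, map_smul, Finset.smul_sum, smul_smul]
  exact sum_range_mul_range_of_antidiagonal (fun k l =>
    ((k.factorial : ℂ)⁻¹ * (l.factorial : ℂ)⁻¹) • (A ^ k) ((B ^ l) v)) (N + N)
    fun k l h => by rw [hz k l h, smul_zero]

theorem expApply_zero (v : M) : expApply (0 : Module.End ℂ M) v = v := by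
  rw [expApply_eq_sum (n := 1) (by simp)]
  simp

theorem LocallyNilpotent.neg {A : Module.End ℂ M} (hA : LocallyNilpotent A) :
    LocallyNilpotent (-A) := fun v => by
  obtain ⟨n, hn⟩ := hA v
  refine ⟨n, ?_⟩
  rw [neg_pow, ← neg_one_smul ℂ (1 : Module.End ℂ M), smul_pow, one_pow, smul_mul_assoc, one_mul,
    LinearMap.smul_apply, hn, smul_zero]

theorem expApply_mem {A : Module.End ℂ M} (p : Submodule ℂ M) (hp : ∀ v ∈ p, A v ∈ p)
    {v : M} (hv : v ∈ p) : expApply A v ∈ p := by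
  have h : ∀ k, (A ^ k) v ∈ p := fun k => by
    induction k with
    | zero => simpa using hv
    | succ k ih => rw [pow_succ', Module.End.mul_apply]; exact hp _ ih
  unfold expApply
  -- If the support were infinite, the sum would take the default value `0`, which also lies in `p`.
  exact finsum_induction (· ∈ p) p.zero_mem (fun _ _ => p.add_mem)
    fun k => p.smul_mem _ (h k)

theorem locallyNilpotent_of_pow_tmul {A : Module.End ℂ (M ⊗[ℂ] N)}
    (h : ∀ v w, ∃ n : ℕ, (A ^ n) (v ⊗ₜ[ℂ] w) = 0) : LocallyNilpotent A := by
  intro u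
  induction u using TensorProduct.induction_on with
  | zero => exact ⟨0, map_zero _⟩
  | tmul v w => exact h v w
  | add x y hx hy =>
    obtain ⟨n, hn⟩ := hx
    obtain ⟨m, hm⟩ := hy
    exact ⟨max n m, by rw [map_add, pow_apply_eq_zero_of_le hn (le_max_left _ _),
      pow_apply_eq_zero_of_le hm (le_max_right _ _), add_zero]⟩

theorem rTensor_pow_tmul (A : Module.End ℂ M) (k : ℕ) (v : M) (w : N) :
    ((LinearMap.rTensor N A : Module.End ℂ (M ⊗[ℂ] N)) ^ k) (v ⊗ₜ[ℂ] w) =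
      (A ^ k) v ⊗ₜ[ℂ] w := by
  exact LinearMap.congr_fun (LinearMap.rTensor_pow (N := N) A k) (v ⊗ₜ[ℂ] w)

theorem lTensor_pow_tmul (A : Module.End ℂ N) (k : ℕ) (v : M) (w : N) :
    ((LinearMap.lTensor M A : Module.End ℂ (M ⊗[ℂ] N)) ^ k) (v ⊗ₜ[ℂ] w) =
      v ⊗ₜ[ℂ] (A ^ k) w := by
  exact LinearMap.congr_fun (LinearMap.lTensor_pow (M := M) A k) (v ⊗ₜ[ℂ] w)

/-- The operators `A ⊗ 1` and `1 ⊗ B` commute, so the exponential of their sum is the product of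
their exponentials. This turns the group-like action `g ⊗ g` into the exponential of a
derivation-like one. -/
theorem expApply_tmul {A : Module.End ℂ M} {B : Module.End ℂ N} (hA : LocallyNilpotent A)
    (hB : LocallyNilpotent B) (v : M) (w : N) :
    expApply A v ⊗ₜ[ℂ] expApply B w =
      expApply (LinearMap.rTensor N A + LinearMap.lTensor M B) (v ⊗ₜ[ℂ] w) := by
  rw [← expApply_add
    (locallyNilpotent_of_pow_tmul fun v w => ?_) (locallyNilpotent_of_pow_tmul fun v w => ?_)]
  · obtain ⟨n, hn⟩ := hA v
    obtain ⟨m, hm⟩ := hB w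
    rw [expApply_eq_sum hn, expApply_eq_sum hm, expApply_eq_sum (n := m) (v := v ⊗ₜ[ℂ] w)
      (by rw [lTensor_pow_tmul, hm, TensorProduct.tmul_zero])]
    simp_rw [lTensor_pow_tmul, ← TensorProduct.tmul_smul, ← TensorProduct.tmul_sum]
    rw [expApply_eq_sum (n := n) (by rw [rTensor_pow_tmul, hn, TensorProduct.zero_tmul])]
    simp_rw [rTensor_pow_tmul, TensorProduct.smul_tmul', ← TensorProduct.sum_tmul]
  · exact (LinearMap.rTensor_comp_lTensor _ _ _).trans
      (LinearMap.lTensor_comp_rTensor _ _ _).symm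
  · obtain ⟨n, hn⟩ := hA v
    exact ⟨n, by rw [rTensor_pow_tmul, hn, TensorProduct.zero_tmul]⟩
  · obtain ⟨n, hn⟩ := hB w
    exact ⟨n, by rw [lTensor_pow_tmul, hn, TensorProduct.tmul_zero]⟩

end ExpApply

/-! ### Commutation and multiplicativity of the vertex operators `V_m(z)`. -/

section Vertex

theorem coeff_zero_creationExponent (m : ℤ) : PowerSeries.coeff 0 (creationExponent m) = 0 := by
  rw [creationExponent, PowerSeries.coeff_mk, dif_neg (lt_irrefl 0)]

theorem coeff_zero_annihilationExponent (m : ℤ) :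
    PowerSeries.coeff 0 (annihilationExponent m) = 0 := by
  rw [annihilationExponent, PowerSeries.coeff_mk, dif_neg (lt_irrefl 0)]

/-- Linearity of the exponent in `m` puts all products in the scope of `expSeries_mul_expSeries`,
with `f` the exponent for `m = 1`. -/
theorem creationExponent_eq_smul (m : ℤ) :
    creationExponent m = (m : ℂ) • creationExponent 1 := by
  ext1 n
  rw [PowerSeries.coeff_smul, creationExponent, creationExponent, PowerSeries.coeff_mk,
    PowerSeries.coeff_mk]
  split_ifs
  · rw [Int.cast_one, one_smul]
  · rw [smul_zero]

theorem annihilationExponent_eq_smul (m : ℤ) :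
    annihilationExponent m = (m : ℂ) • annihilationExponent 1 := by
  ext1 n
  rw [PowerSeries.coeff_smul, annihilationExponent, annihilationExponent, PowerSeries.coeff_mk,
    PowerSeries.coeff_mk]
  split_ifs
  · rw [smul_smul, Int.cast_one]
    congr 1
    ring
  · rw [smul_zero]

theorem expSeries_creationExponent_mul (m m' : ℤ) :
    expSeries (creationExponent m) * expSeries (creationExponent m') =
      expSeries (creationExponent (m + m')) := by
  rw [creationExponent_eq_smul m, creationExponent_eq_smul m', creationExponent_eq_smul (m + m'),
    expSeries_mul_expSeries (coeff_zero_creationExponent 1), Int.cast_add]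

theorem expSeries_annihilationExponent_mul (m m' : ℤ) :
    expSeries (annihilationExponent m) * expSeries (annihilationExponent m') =
      expSeries (annihilationExponent (m + m')) := by
  rw [annihilationExponent_eq_smul m, annihilationExponent_eq_smul m',
    annihilationExponent_eq_smul (m + m'),
    expSeries_mul_expSeries (coeff_zero_annihilationExponent 1), Int.cast_add]

theorem commute_yMul (i j : ℕ+) : Commute (yMul i) (yMul j) :=
  LinearMap.ext fun p => mul_left_comm _ _ p

/-- The variables `y` and `y*` are independent, so creation and annihilation parts have no
contraction. This is why products of the `V_m` need no normal ordering. -/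
theorem commute_yMul_yStarDeriv (i j : ℕ+) : Commute (yMul i) (yStarDeriv j) := by
  refine LinearMap.ext fun p => ?_
  change MvPolynomial.X (Sum.inl i) * MvPolynomial.pderiv (R := ℂ) (Sum.inr j) p =
    MvPolynomial.pderiv (R := ℂ) (Sum.inr j) (MvPolynomial.X (Sum.inl i) * p)
  rw [Derivation.leibniz, MvPolynomial.pderiv_X_of_ne (by simp), smul_zero, add_zero, smul_eq_mul]

/-- The commutator of two derivations is a derivation, and this one kills every variable. -/
theorem commute_yStarDeriv (i j : ℕ+) : Commute (yStarDeriv i) (yStarDeriv j) := by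
  have h : ⁅MvPolynomial.pderiv (R := ℂ) (σ := ℕ+ ⊕ ℕ+) (Sum.inr i),
      MvPolynomial.pderiv (R := ℂ) (σ := ℕ+ ⊕ ℕ+) (Sum.inr j)⁆ = 0 := by
    refine MvPolynomial.derivation_ext fun x => ?_
    rw [Derivation.commutator_apply, MvPolynomial.pderiv_X, MvPolynomial.pderiv_X]
    simp only [Pi.single_apply]
    split_ifs <;> simp
  refine LinearMap.ext fun p => sub_eq_zero.1 ?_
  have := congrArg (fun D => D p) h
  rw [Derivation.commutator_apply] at this
  exact this

theorem commute_coeff_creationExponent (m m' : ℤ) (i j : ℕ) :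
    Commute (PowerSeries.coeff i (creationExponent m))
      (PowerSeries.coeff j (creationExponent m')) := by
  rw [creationExponent, creationExponent, PowerSeries.coeff_mk, PowerSeries.coeff_mk]
  split_ifs
  · exact ((commute_yMul _ _).smul_left _).smul_right _
  · exact Commute.zero_right _
  · exact Commute.zero_left _
  · exact Commute.zero_left _

theorem commute_coeff_creationExponent_annihilationExponent (m m' : ℤ) (i j : ℕ) :
    Commute (PowerSeries.coeff i (creationExponent m))
      (PowerSeries.coeff j (annihilationExponent m')) := by
  rw [creationExponent, annihilationExponent, PowerSeries.coeff_mk, PowerSeries.coeff_mk]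
  split_ifs
  · exact ((commute_yMul_yStarDeriv _ _).smul_left _).smul_right _
  · exact Commute.zero_right _
  · exact Commute.zero_left _
  · exact Commute.zero_left _

theorem commute_coeff_annihilationExponent (m m' : ℤ) (i j : ℕ) :
    Commute (PowerSeries.coeff i (annihilationExponent m))
      (PowerSeries.coeff j (annihilationExponent m')) := by
  rw [annihilationExponent, annihilationExponent, PowerSeries.coeff_mk, PowerSeries.coeff_mk]
  split_ifs
  · exact ((commute_yStarDeriv _ _).smul_left _).smul_right _
  · exact Commute.zero_right _
  · exact Commute.zero_left _
  · exact Commute.zero_left _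

theorem commute_creationCoeff (m m' k k' : ℤ) :
    Commute (creationCoeff m k) (creationCoeff m' k') := by
  unfold creationCoeff
  split_ifs
  · exact commute_coeff_expSeries_expSeries (commute_coeff_creationExponent m m') _ _
  · exact Commute.zero_right _
  · exact Commute.zero_left _
  · exact Commute.zero_left _

theorem commute_creationCoeff_annihilationCoeff (m m' k : ℤ) (b : ℕ) :
    Commute (creationCoeff m k) (annihilationCoeff m' b) := by
  unfold creationCoeff
  split_ifs
  · exact commute_coeff_expSeries_expSeries
      (commute_coeff_creationExponent_annihilationExponent m m') _ _
  · exact Commute.zero_left _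

theorem commute_annihilationCoeff (m m' : ℤ) (b b' : ℕ) :
    Commute (annihilationCoeff m b) (annihilationCoeff m' b') :=
  commute_coeff_expSeries_expSeries (commute_coeff_annihilationExponent m m') _ _

theorem commute_apply {M : Type*} [AddCommGroup M] [Module ℂ M] {A B : Module.End ℂ M}
    (h : Commute A B) (v : M) : A (B v) = B (A v) := LinearMap.congr_fun h.eq v

theorem vertexCoeff_eq_sum (m k : ℤ) {p : YPoly} {B : ℕ}
    (hB : ∀ b ≥ B, annihilationCoeff m b p = 0) :
    vertexCoeff m k p =
      ∑ b ∈ Finset.range B, creationCoeff m (k + b) (annihilationCoeff m b p) := by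
  rw [vertexCoeff, locSum_apply]
  refine finsum_eq_sum_of_support_subset _ fun b hb => ?_
  rw [Finset.coe_range, Set.mem_Iio]
  by_contra h
  exact hb (by simp [hB b (not_lt.1 h)])

theorem commute_vertexCoeff_of_commute {A : Module.End ℂ YPoly} {m : ℤ}
    (h1 : ∀ k, Commute A (creationCoeff m k)) (h2 : ∀ b, Commute A (annihilationCoeff m b))
    (k : ℤ) : Commute A (vertexCoeff m k) := by
  refine LinearMap.ext fun p => ?_
  change A (vertexCoeff m k p) = vertexCoeff m k (A p)
  obtain ⟨B, hB⟩ := annihilationCoeff_bdd m p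
  -- A bound `B` valid for `p` is also valid for `A p`, because `A` commutes with the annihilation
  -- coefficients.
  rw [vertexCoeff_eq_sum m k hB, vertexCoeff_eq_sum m k (p := A p) (B := B) fun b hb => by
    rw [← commute_apply (h2 b), hB b hb, map_zero], map_sum]
  refine Finset.sum_congr rfl fun b _ => ?_
  rw [commute_apply (h1 _), commute_apply (h2 _)]

theorem commute_vertexCoeff (m m' k k' : ℤ) :
    Commute (vertexCoeff m k) (vertexCoeff m' k') :=
  commute_vertexCoeff_of_commute
    (fun _ => (commute_vertexCoeff_of_commute (fun _ => commute_creationCoeff _ _ _ _)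
      (fun _ => commute_creationCoeff_annihilationCoeff _ _ _ _) k).symm)
    (fun _ => (commute_vertexCoeff_of_commute
      (fun _ => (commute_creationCoeff_annihilationCoeff _ _ _ _).symm)
      (fun _ => commute_annihilationCoeff _ _ _ _) k).symm) k'

theorem annihilationCoeff_add (m m' : ℤ) (n : ℕ) :
    annihilationCoeff (m + m') n = ∑ x ∈ Finset.HasAntidiagonal.antidiagonal n,
      annihilationCoeff m x.1 * annihilationCoeff m' x.2 := by
  unfold annihilationCoeff
  rw [← expSeries_annihilationExponent_mul, PowerSeries.coeff_mul]

theorem creationCoeff_of_neg (m : ℤ) {k : ℤ} (hk : k < 0) : creationCoeff m k = 0 :=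
  if_neg (not_le.2 hk)

theorem creationCoeff_mul_support_finite (m m' k c d : ℤ) (p : YPoly) :
    (Function.support fun s : ℤ =>
      creationCoeff m (s + c) (creationCoeff m' (k - s + d) p)).Finite := by
  refine (Set.finite_Icc (-c) (k + d)).subset fun s hs => ⟨?_, ?_⟩ <;> by_contra h <;> refine hs ?_
  · change creationCoeff m (s + c) _ = 0
    rw [creationCoeff_of_neg m (by omega), LinearMap.zero_apply]
  · change creationCoeff m (s + c) _ = 0
    rw [creationCoeff_of_neg m' (by omega), LinearMap.zero_apply, map_zero]

/-- A Cauchy product of power series, indexed by `ℤ` with zero coefficients in negative degrees. -/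
theorem finsum_creationCoeff_mul (m m' k : ℤ) (p : YPoly) :
    ∑ᶠ s : ℤ, creationCoeff m s (creationCoeff m' (k - s) p) = creationCoeff (m + m') k p := by
  rcases lt_or_ge k 0 with hk | hk
  · rw [creationCoeff_of_neg _ hk, LinearMap.zero_apply]
    refine (finsum_congr fun s => ?_).trans finsum_zero
    rcases lt_or_ge s 0 with hs | hs
    · rw [creationCoeff_of_neg m hs, LinearMap.zero_apply]
    · rw [creationCoeff_of_neg m' (by omega), LinearMap.zero_apply, map_zero]
  · lift k to ℕ using hk
    have e : ∀ (m : ℤ) (n : ℕ),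
        creationCoeff m n = PowerSeries.coeff n (expSeries (creationExponent m)) := fun m n => by
      rw [creationCoeff, if_pos (Int.natCast_nonneg n), Int.toNat_natCast]
    rw [e, ← expSeries_creationExponent_mul, PowerSeries.coeff_mul, LinearMap.sum_apply,
      Finset.Nat.sum_antidiagonal_eq_sum_range_succ
        (fun i j => (PowerSeries.coeff i (expSeries (creationExponent m)) *
          PowerSeries.coeff j (expSeries (creationExponent m'))) p)]
    rw [finsum_eq_sum_of_support_subset (s := (Finset.range (k + 1)).map Nat.castEmbedding),
      Finset.sum_map]
    · refine Finset.sum_congr rfl fun i hi => ?_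
      have hi' : i ≤ k := by simpa [Nat.lt_succ_iff] using hi
      rw [Nat.castEmbedding_apply, ← Nat.cast_sub hi', e, e, Module.End.mul_apply]
    · intro s hs
      have h0 : 0 ≤ s := by
        by_contra h
        exact hs (by
          change creationCoeff m s _ = 0
          rw [creationCoeff_of_neg m (not_le.1 h), LinearMap.zero_apply])
      have h1 : s ≤ k := by
        by_contra h
        exact hs (by
          change creationCoeff m s _ = 0
          rw [creationCoeff_of_neg m' (by omega), LinearMap.zero_apply, map_zero])
      lift s to ℕ using h0
      simp only [Finset.coe_map, Finset.coe_range, Set.mem_image, Set.mem_Iio]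
      exact ⟨s, by omega, rfl⟩

/-- The annihilation part of the left factor is moved past the creation part of the right one. The
sum over `s` then multiplies the creation parts, and the sum over `(b, b')` multiplies the
annihilation parts. -/
theorem finsum_vertexCoeff_mul (m m' k : ℤ) (p : YPoly) :
    ∑ᶠ s : ℤ, vertexCoeff m s (vertexCoeff m' (k - s) p) = vertexCoeff (m + m') k p := by
  obtain ⟨B₁, hB₁⟩ := annihilationCoeff_bdd m p
  obtain ⟨B₂, hB₂⟩ := annihilationCoeff_bdd m' p
  set N := B₁ + B₂
  have h2 : ∀ b ≥ N, annihilationCoeff m' b p = 0 := fun b hb => hB₂ b (by omega)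
  -- With `N = B₁ + B₂`, either `b' ≥ B₂` or `b ≥ B₁`. In the second case the factors are swapped
  -- first, since `B₁` is a bound for `p` itself.
  have hz : ∀ b b', N ≤ b + b' → annihilationCoeff m b (annihilationCoeff m' b' p) = 0 := by
    intro b b' h
    rcases le_or_gt B₂ b' with h' | h'
    · rw [hB₂ b' h', map_zero]
    · rw [commute_apply (commute_annihilationCoeff _ _ _ _), hB₁ b (by omega), map_zero]
  have h3 : ∀ b ≥ N, annihilationCoeff (m + m') b p = 0 := fun b hb => by
    rw [annihilationCoeff_add, LinearMap.sum_apply]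
    refine Finset.sum_eq_zero fun x hx => hz _ _ ?_
    have hx' : x.1 + x.2 = b := by simpa using hx
    omega
  have e1 : ∀ s : ℤ, vertexCoeff m s (vertexCoeff m' (k - s) p) =
      ∑ b ∈ Finset.range N, ∑ b' ∈ Finset.range N, creationCoeff m (s + b)
        (creationCoeff m' (k - s + b') (annihilationCoeff m b (annihilationCoeff m' b' p))) := by
    intro s
    rw [vertexCoeff_eq_sum m' (k - s) h2, map_sum, Finset.sum_comm]
    refine Finset.sum_congr rfl fun b' _ => ?_
    rw [vertexCoeff_eq_sum m s (B := N) fun b hb => by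
      rw [← commute_apply (commute_creationCoeff_annihilationCoeff _ _ _ _),
        hz b b' (by omega), map_zero]]
    refine Finset.sum_congr rfl fun b _ => ?_
    rw [← commute_apply (commute_creationCoeff_annihilationCoeff m' m (k - s + b') b)]
  have e2 : ∀ (b b' : ℕ) (q : YPoly),
      ∑ᶠ s : ℤ, creationCoeff m (s + b) (creationCoeff m' (k - s + b') q) =
        creationCoeff (m + m') (k + (b + b' : ℕ)) q := by
    intro b b' q
    rw [← finsum_creationCoeff_mul, ← finsum_comp_equiv (Equiv.addRight (b : ℤ)) (f := fun s =>
      creationCoeff m s (creationCoeff m' (k + (b + b' : ℕ) - s) q))]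
    refine finsum_congr fun s => ?_
    rw [Equiv.coe_addRight]
    congr 3
    push_cast
    ring
  rw [finsum_congr e1, finsum_sum_comm]
  · refine (Finset.sum_congr rfl fun (b : ℕ) _ => (finsum_sum_comm _ _ fun (b' : ℕ) _ =>
      creationCoeff_mul_support_finite m m' k b b' _).trans
        (Finset.sum_congr rfl fun (b' : ℕ) _ => e2 b b' _)).trans ?_
    rw [sum_range_mul_range_of_antidiagonal (fun b b' => creationCoeff (m + m') (k + (b + b' : ℕ))
      (annihilationCoeff m b (annihilationCoeff m' b' p))) N
      (fun b b' h => by rw [hz b b' h, map_zero]), vertexCoeff_eq_sum _ _ h3]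
    refine Finset.sum_congr rfl fun n _ => ?_
    rw [annihilationCoeff_add, LinearMap.sum_apply, map_sum]
    refine Finset.sum_congr rfl fun x hx => ?_
    have hx' : x.1 + x.2 = n := by simpa using hx
    rw [hx', Module.End.mul_apply]
  · intro b _
    refine (Set.Finite.biUnion (Finset.range N).finite_toSet fun b' _ =>
      creationCoeff_mul_support_finite m m' k b b'
        (annihilationCoeff m b (annihilationCoeff m' b' p))).subset ?_
    intro s hs
    obtain ⟨b', hb', h⟩ := Finset.exists_ne_zero_of_sum_ne_zero hs
    exact Set.mem_biUnion hb' h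

/-- The coefficients of `V_m(z)` and `V_{m'}(z)` commute. -/
theorem commute_coeff_V (m m' k k' : ℤ) :
    Commute (HVertexOperator.coeff (V m) k) (HVertexOperator.coeff (V m') k') := by
  change TensorProduct.map _ _ * TensorProduct.map _ _ =
    TensorProduct.map _ _ * TensorProduct.map _ _
  rw [← TensorProduct.map_mul, ← TensorProduct.map_mul, (commute_vertexCoeff m m' k k').eq]
  congr 1
  exact LinearMap.ext fun p => mul_left_comm _ _ p

theorem coeff_V_mul_support_finite (m m' k : ℤ) (w : FD) : (Function.support fun s : ℤ =>
    HVertexOperator.coeff (V m) s (HVertexOperator.coeff (V m') (k - s) w)).Finite := by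
  obtain ⟨N, hN⟩ := coeff_bdd (V m) w
  obtain ⟨M, hM⟩ := coeff_bdd (V m') w
  refine (Set.finite_Icc N (k - M)).subset fun s hs => ⟨?_, ?_⟩ <;> by_contra h <;>
    refine hs ?_ <;> beta_reduce
  -- The truncation of `V m` is known on `w` only, so its mode is first commuted to act directly on
  -- `w`.
  · rw [commute_apply (commute_coeff_V _ _ _ _), hN s (by omega), map_zero]
  · rw [hM _ (by omega), map_zero]

/-- `V_m(z) V_{m'}(z) = V_{m+m'}(z)`. -/
theorem finsum_coeff_V_mul (m m' k : ℤ) (w : FD) :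
    ∑ᶠ s : ℤ, HVertexOperator.coeff (V m) s (HVertexOperator.coeff (V m') (k - s) w) =
      HVertexOperator.coeff (V (m + m')) k w := by
  induction w using TensorProduct.induction_on with
  | zero => simp only [map_zero, finsum_zero]
  | tmul p q =>
    change ∑ᶠ s : ℤ, vertexCoeff m s (vertexCoeff m' (k - s) p) ⊗ₜ[ℂ]
      (LaurentPolynomial.T m * (LaurentPolynomial.T m' * q)) =
      vertexCoeff (m + m') k p ⊗ₜ[ℂ] (LaurentPolynomial.T (m + m') * q)
    have hf : (Function.support fun s : ℤ =>
        vertexCoeff m s (vertexCoeff m' (k - s) p)).Finite := by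
      obtain ⟨N, hN⟩ := vertexCoeff_bdd m p
      obtain ⟨M, hM⟩ := vertexCoeff_bdd m' p
      refine (Set.finite_Icc N (k - M)).subset fun s hs => ⟨?_, ?_⟩ <;> by_contra h <;>
        refine hs ?_ <;> beta_reduce
      · rw [commute_apply (commute_vertexCoeff _ _ _ _), hN s (by omega), map_zero]
      · rw [hM _ (by omega), map_zero]
    rw [← finsum_vertexCoeff_mul, ← mul_assoc, ← LaurentPolynomial.T_add]
    exact (AddMonoidHom.map_finsum ((TensorProduct.mk ℂ YPoly ℂ[T;T⁻¹]).flip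
      (LaurentPolynomial.T (m + m') * q)).toAddMonoidHom hf).symm
  | add x y hx hy =>
    simp only [map_add]
    rw [finsum_add_distrib (coeff_V_mul_support_finite m m' k x)
      (coeff_V_mul_support_finite m m' k y), hx, hy]

end Vertex

/-! ### Commutators of the currents with the fermion modes. -/

section Fermion

theorem psi_mul_psi (k l : ℤ) : psi k * psi l = -(psi l * psi k) := by
  rw [eq_neg_iff_add_eq_zero]
  change act _ * act _ + act _ * act _ = 0
  rw [← map_mul, ← map_mul, ← map_add, gen_rel (FermionRel.psi_psi k l), map_zero, map_zero]

theorem psiStar_mul_psiStar (k l : ℤ) : psiStar k * psiStar l = -(psiStar l * psiStar k) := by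
  rw [eq_neg_iff_add_eq_zero]
  change act _ * act _ + act _ * act _ = 0
  rw [← map_mul, ← map_mul, ← map_add, gen_rel (FermionRel.star_star k l), map_zero, map_zero]

theorem psiStar_mul_psi (k l : ℤ) :
    psiStar k * psi l = (if k + l + 1 = 0 then 1 else 0) - psi l * psiStar k := by
  rw [eq_sub_iff_add_eq]
  change act _ * act _ + act _ * act _ = _
  rw [← map_mul, ← map_mul, ← map_add, gen_rel (FermionRel.star_psi k l)]
  split_ifs <;> simp only [map_one, map_zero]

/-- Normal ordering changes the product by a scalar, which drops out of every commutator. -/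
theorem normalOrder_eq (k l : ℤ) :
    ∃ c : ℂ, normalOrder k l = psi k * psiStar l - c • 1 := by
  rw [normalOrder]
  split_ifs
  · exact ⟨0, by rw [zero_smul, sub_zero]⟩
  · rw [psiStar_mul_psi]
    split_ifs
    · exact ⟨1, by rw [one_smul, neg_sub]⟩
    · exact ⟨0, by rw [zero_smul, zero_sub, neg_neg, sub_zero]⟩

theorem normalOrder_commutator_psi (k l p : ℤ) :
    normalOrder k l * psi p - psi p * normalOrder k l = if l + p + 1 = 0 then psi k else 0 := by
  obtain ⟨c, hc⟩ := normalOrder_eq k l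
  have h : psi k * psiStar l * psi p - psi p * (psi k * psiStar l) =
      psi k * (if l + p + 1 = 0 then 1 else 0) := by
    rw [mul_assoc, psiStar_mul_psi, ← mul_assoc (psi p), psi_mul_psi p k]
    noncomm_ring
  rw [hc, sub_mul, mul_sub, smul_mul_assoc, mul_smul_comm, one_mul, mul_one,
    sub_sub_sub_cancel_right, h]
  split_ifs
  · rw [mul_one]
  · rw [mul_zero]

theorem normalOrder_commutator_psiStar (k l p : ℤ) :
    normalOrder k l * psiStar p - psiStar p * normalOrder k l =
      if p + k + 1 = 0 then -psiStar l else 0 := by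
  obtain ⟨c, hc⟩ := normalOrder_eq k l
  have h : psi k * psiStar l * psiStar p - psiStar p * (psi k * psiStar l) =
      -((if p + k + 1 = 0 then 1 else 0) * psiStar l) := by
    rw [mul_assoc, psiStar_mul_psiStar l p, ← mul_assoc (psiStar p), psiStar_mul_psi]
    noncomm_ring
  rw [hc, sub_mul, mul_sub, smul_mul_assoc, mul_smul_comm, one_mul, mul_one,
    sub_sub_sub_cancel_right, h]
  split_ifs
  · rw [one_mul]
  · rw [zero_mul, neg_zero]

theorem piInf_commutator (a : bandedMatrix) (A : Module.End ℂ FA) (v : FA) :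
    piInf a (A v) - A (piInf a v) = ∑ᶠ p : ℤ × ℤ, a.1 p.1 p.2 •
      (normalOrder (-p.1 - 1) p.2 * A - A * normalOrder (-p.1 - 1) p.2) v := by
  have h1 := piInf_support_finite a (A v)
  have h2 := support_map_finite A (piInf_support_finite a v)
  change (∑ᶠ p : ℤ × ℤ, _) - A (locSum _ (piInf_support_finite a) v) = _
  rw [map_locSum, ← finsum_sub_distrib h1 h2]
  refine finsum_congr fun p => ?_
  simp only [LinearMap.smul_apply, LinearMap.sub_apply, Module.End.mul_apply, map_smul, smul_sub]

theorem finsum_eq_sum_of_injective {ι κ M : Type*} [AddCommMonoid M] [Fintype κ] (e : κ → ι)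
    (he : Function.Injective e) (F : ι → M) (hF : ∀ i, F i ≠ 0 → ∃ a, e a = i) :
    ∑ᶠ i, F i = ∑ a, F (e a) := by
  rw [finsum_eq_sum_of_support_subset (s := Finset.univ.map ⟨e, he⟩), Finset.sum_map]
  · rfl
  · intro i hi
    obtain ⟨a, rfl⟩ := hF i hi
    simp

variable (ℓ : ℕ) [NeZero ℓ]

theorem divModEquiv_add_mul (b : Fin ℓ) (r : ℤ) :
    Int.divModEquiv ℓ ((b : ℕ) + r * ℓ : ℤ) = (r, b) := by
  rw [← Equiv.eq_symm_apply]
  simp [Int.divModEquiv, add_comm]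

theorem exists_eq_add_mul (i : ℤ) : ∃ (a : Fin ℓ) (t : ℤ), i = (a : ℕ) + t * ℓ :=
  ⟨(Int.divModEquiv ℓ i).2, (Int.divModEquiv ℓ i).1, by
    apply (Int.divModEquiv ℓ).injective
    rw [divModEquiv_add_mul]⟩

theorem add_mul_injective (t : ℤ) :
    Function.Injective fun a : Fin ℓ => ((a : ℕ) + t * ℓ : ℤ) := fun a b h => by
  have h' : (a : ℕ) + t * ℓ = ((b : ℕ) + t * ℓ : ℤ) := h
  have := congrArg (Int.divModEquiv ℓ) h'
  rw [divModEquiv_add_mul, divModEquiv_add_mul] at this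
  exact (Prod.mk.inj this).2

theorem blockMatrix_add_mul (n : ℤ) (X : Matrix (Fin ℓ) (Fin ℓ) ℂ) (a b : Fin ℓ) (r s : ℤ) :
    blockMatrix ℓ n X ((a : ℕ) + r * ℓ) ((b : ℕ) + s * ℓ) = if s = r + n then X a b else 0 := by
  simp only [blockMatrix, Matrix.of_apply, divModEquiv_add_mul]

theorem coeff_psiField (c : ℤ) : HVertexOperator.coeff psiField c = psi (-c - 1) := rfl

theorem coeff_psiStarField (c : ℤ) : HVertexOperator.coeff psiStarField c = psiStar (-c - 1) := rfl

/-- Only the matrix entries in column `b + rℓ` contribute. Periodicity of the block matrix confines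
them to the row block `r - s`, leaving one term for each `a`. -/
theorem currentMode_commutator_psi (X : SlAlg ℓ) (b : Fin ℓ) (s r : ℤ) (v : FA) :
    currentMode ℓ s X (HVertexOperator.coeff psiField ((b : ℕ) + r * ℓ) v) -
      HVertexOperator.coeff psiField ((b : ℕ) + r * ℓ) (currentMode ℓ s X v) =
      ∑ a : Fin ℓ, X.1 a b •
        HVertexOperator.coeff psiField ((a : ℕ) + (r - s) * ℓ) v := by
  refine (piInf_commutator (iotaMatrix ℓ s X) _ v).trans ?_
  rw [finsum_eq_sum_of_injective
    (fun a : Fin ℓ => (((a : ℕ) + (r - s) * ℓ, (b : ℕ) + r * ℓ) : ℤ × ℤ))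
    fun a a' h => add_mul_injective ℓ (r - s) (Prod.mk.inj h).1]
  · refine Finset.sum_congr rfl fun a _ => ?_
    change blockMatrix ℓ s X.1 ((a : ℕ) + (r - s) * ℓ) ((b : ℕ) + r * ℓ) • _ = _
    rw [blockMatrix_add_mul, if_pos (by ring), coeff_psiField, normalOrder_commutator_psi,
      if_pos (by ring), coeff_psiField]
  · rintro ⟨i, k⟩ h
    obtain ⟨a, t, rfl⟩ := exists_eq_add_mul ℓ i
    have hk : k = (b : ℕ) + r * ℓ := by
      by_contra hk
      refine h ?_
      rw [coeff_psiField, normalOrder_commutator_psi, if_neg (by dsimp only; omega),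
        LinearMap.zero_apply, smul_zero]
    subst hk
    have ht : r = t + s := by
      by_contra ht
      refine h ?_
      change blockMatrix ℓ s X.1 ((a : ℕ) + t * ℓ) ((b : ℕ) + r * ℓ) • _ = _
      rw [blockMatrix_add_mul, if_neg ht, zero_smul]
    exact ⟨a, by rw [ht, add_sub_cancel_right]⟩

/-- The coefficient of `λ^{-1-a+rℓ}` is the `ψ*` mode dual to position `a` of block `-r`. In this
numbering `ψ*` has the same block shift as `ψ` and transforms by minus the transpose. -/
theorem currentMode_commutator_psiStar (X : SlAlg ℓ) (a : Fin ℓ) (s r : ℤ) (v : FA) :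
    currentMode ℓ s X (HVertexOperator.coeff psiStarField (-1 - (a : ℕ) + r * ℓ) v) -
      HVertexOperator.coeff psiStarField (-1 - (a : ℕ) + r * ℓ) (currentMode ℓ s X v) =
      ∑ b : Fin ℓ, (-X.1 a b) •
        HVertexOperator.coeff psiStarField (-1 - (b : ℕ) + (r - s) * ℓ) v := by
  refine (piInf_commutator (iotaMatrix ℓ s X) _ v).trans ?_
  rw [finsum_eq_sum_of_injective
    (fun b : Fin ℓ => (((a : ℕ) + (-r) * ℓ, (b : ℕ) + (s - r) * ℓ) : ℤ × ℤ))
    fun b b' h => add_mul_injective ℓ (s - r) (Prod.mk.inj h).2]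
  · refine Finset.sum_congr rfl fun b _ => ?_
    change blockMatrix ℓ s X.1 ((a : ℕ) + (-r) * ℓ) ((b : ℕ) + (s - r) * ℓ) • _ = _
    rw [blockMatrix_add_mul, if_pos (by ring), coeff_psiStarField, normalOrder_commutator_psiStar,
      if_pos (by ring), coeff_psiStarField, LinearMap.neg_apply, smul_neg, neg_smul]
    congr 4
    ring
  · rintro ⟨i, k⟩ h
    obtain ⟨b, t, rfl⟩ := exists_eq_add_mul ℓ k
    have hi : i = (a : ℕ) + (-r) * ℓ := by
      by_contra hi
      refine h ?_
      rw [coeff_psiStarField, normalOrder_commutator_psiStar,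
        if_neg (by rw [neg_mul] at hi; dsimp only; omega), LinearMap.zero_apply, smul_zero]
    subst hi
    have ht : t = -r + s := by
      by_contra ht
      refine h ?_
      change blockMatrix ℓ s X.1 ((a : ℕ) + (-r) * ℓ) ((b : ℕ) + t * ℓ) • _ = _
      rw [blockMatrix_add_mul, if_neg ht, zero_smul]
    exact ⟨b, by rw [ht, neg_add_eq_sub]⟩

end Fermion

theorem finsum_comp_of_injective {ι κ M : Type*} [AddCommMonoid M] {e : κ → ι}
    (he : Function.Injective e) (F : ι → M) (hF : ∀ i, F i ≠ 0 → ∃ a, e a = i) :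
    ∑ᶠ i, F i = ∑ᶠ a, F (e a) := by
  rw [← finsum_mem_range he, finsum_mem_def, Set.indicator_eq_self.2]
  exact fun i hi => hF i hi

/-! ### Commutators of the toroidal modes with the fields `ψ(λ) V_k(λ^ℓ)` and `ψ*(λ) V_k(λ^ℓ)`. -/

section Intertwining

variable (ℓ : ℕ) [NeZero ℓ]

theorem coeff_tensorField_tmul {V W : Type*} [AddCommGroup V] [Module ℂ V] [AddCommGroup W]
    [Module ℂ W] (A : VertexOperator ℂ V) (B : VertexOperator ℂ W) (k : ℤ) (v : V) (w : W) :
    HVertexOperator.coeff (tensorField A B) k (v ⊗ₜ[ℂ] w) =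
      ∑ᶠ a : ℤ, HVertexOperator.coeff A a v ⊗ₜ[ℂ] HVertexOperator.coeff B (k - a) w := rfl

theorem coeff_substPow {W : Type*} [AddCommGroup W] [Module ℂ W] (B : VertexOperator ℂ W) (c : ℤ) :
    HVertexOperator.coeff (substPow ℓ B) c =
      if (ℓ : ℤ) ∣ c then HVertexOperator.coeff B (c / ℓ) else 0 := rfl

/-- The factor `B(λ^ℓ)` supplies only exponents divisible by `ℓ`, so the modes of `A` that enter all
have the residue of `e`. -/
theorem coeff_tensorField_substPow {W : Type*} [AddCommGroup W] [Module ℂ W]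
    (A : VertexOperator ℂ FA) (B : VertexOperator ℂ W)
    (e d : ℤ) (v : FA) (w : W) :
    HVertexOperator.coeff (tensorField A (substPow ℓ B)) (e + d * ℓ) (v ⊗ₜ[ℂ] w) =
      ∑ᶠ r : ℤ, HVertexOperator.coeff A (e + r * ℓ) v ⊗ₜ[ℂ] HVertexOperator.coeff B (d - r) w := by
  have hℓ : (ℓ : ℤ) ≠ 0 := by exact_mod_cast NeZero.ne ℓ
  rw [coeff_tensorField_tmul, finsum_comp_of_injective (e := fun r : ℤ => e + r * ℓ)]
  · refine finsum_congr fun r => ?_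
    have h : e + d * ℓ - (e + r * ℓ) = (d - r) * ℓ := by ring
    rw [coeff_substPow, h, if_pos (dvd_mul_left _ _), Int.mul_ediv_cancel _ hℓ]
  · intro r r' h
    exact mul_right_cancel₀ hℓ (add_left_cancel h)
  · intro i hi
    by_cases h : (ℓ : ℤ) ∣ e + d * ℓ - i
    · obtain ⟨t, ht⟩ := h
      exact ⟨d - t, by linear_combination ht⟩
    · refine absurd ?_ hi
      rw [coeff_substPow, if_neg h, LinearMap.zero_apply, TensorProduct.tmul_zero]

theorem torMode_tmul (n m : ℤ) (X : SlAlg ℓ) (v : FA) (w : FD) :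
    torMode ℓ n m X (v ⊗ₜ[ℂ] w) =
      ∑ᶠ s : ℤ, currentMode ℓ s X v ⊗ₜ[ℂ] HVertexOperator.coeff (V m) (s - n) w := by
  rw [← finsum_comp_equiv (Equiv.subLeft (-1 : ℤ))]
  refine finsum_congr fun a => ?_
  change currentMode ℓ (-a - 1) X v ⊗ₜ[ℂ] HVertexOperator.coeff (V m) (-n - 1 - a) w = _
  rw [Equiv.subLeft_apply, show -n - 1 - a = -1 - a - n by ring, show -a - 1 = -1 - a by ring]

theorem torMode_support_finite (n m : ℤ) (X : SlAlg ℓ) (v : FA) (w : FD) :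
    (Function.support fun s : ℤ =>
      currentMode ℓ s X v ⊗ₜ[ℂ] HVertexOperator.coeff (V m) (s - n) w).Finite := by
  obtain ⟨N, hN⟩ := currentMode_bdd ℓ X v
  obtain ⟨M, hM⟩ := coeff_bdd (V m) w
  refine (Set.finite_Icc (M + n) N).subset fun s hs => ⟨?_, ?_⟩ <;> by_contra h <;>
    refine hs ?_ <;> beta_reduce
  · rw [hM _ (by omega), TensorProduct.tmul_zero]
  · rw [hN _ (by omega), TensorProduct.zero_tmul]

theorem coeff_add_mul_bdd (A : VertexOperator ℂ FA) (e : ℤ) (v : FA) :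
    ∃ N : ℤ, ∀ r < N, HVertexOperator.coeff A (e + r * ℓ) v = 0 := by
  have hℓ : (1 : ℤ) ≤ ℓ := by exact_mod_cast NeZero.one_le
  obtain ⟨N, hN⟩ := coeff_bdd A v
  refine ⟨-|N - e|, fun r hr => hN _ ?_⟩
  have h1 := neg_abs_le (N - e)
  have h2 := abs_nonneg (N - e)
  nlinarith

theorem field_support_finite (A : VertexOperator ℂ FA) (e d k : ℤ) (v : FA) (w : FD) :
    (Function.support fun r : ℤ =>
      HVertexOperator.coeff A (e + r * ℓ) v ⊗ₜ[ℂ]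
        HVertexOperator.coeff (V k) (d - r) w).Finite := by
  obtain ⟨N, hN⟩ := coeff_add_mul_bdd ℓ A e v
  obtain ⟨M, hM⟩ := coeff_bdd (V k) w
  refine (Set.finite_Icc N (d - M)).subset fun s hs => ⟨?_, ?_⟩ <;> by_contra h <;>
    refine hs ?_ <;> beta_reduce
  · rw [hN _ (by omega), TensorProduct.zero_tmul]
  · rw [hM _ (by omega), TensorProduct.tmul_zero]

/-- A current whose commutators with the modes of `A` shift these modes by multiples of `ℓ` has
analogous commutators with the modes of `A(λ) V_k(λ^ℓ)`. -/
theorem torMode_commutator_of_current (A : VertexOperator ℂ FA) (X : SlAlg ℓ) (e : ℤ)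
    (E : Fin ℓ → ℤ) (x : Fin ℓ → ℂ)
    (hA : ∀ s r v, currentMode ℓ s X (HVertexOperator.coeff A (e + r * ℓ) v) -
      HVertexOperator.coeff A (e + r * ℓ) (currentMode ℓ s X v) =
        ∑ a, x a • HVertexOperator.coeff A (E a + (r - s) * ℓ) v)
    (n m k d : ℤ) (u : FTor) :
    torMode ℓ n m X (HVertexOperator.coeff (tensorField A (substPow ℓ (V k))) (e + d * ℓ) u) -
      HVertexOperator.coeff (tensorField A (substPow ℓ (V k))) (e + d * ℓ) (torMode ℓ n m X u) =
      ∑ a, x a • HVertexOperator.coeff (tensorField A (substPow ℓ (V (m + k))))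
        (E a + (d - n) * ℓ) u := by
  induction u using TensorProduct.induction_on with
  | zero => simp only [map_zero, smul_zero, Finset.sum_const_zero, sub_zero]
  | add u u' hu hu' =>
    simp only [map_add, smul_add, Finset.sum_add_distrib, ← hu, ← hu']
    abel
  | tmul v w =>
    obtain ⟨M₁, hM₁⟩ := coeff_bdd (V m) w
    obtain ⟨M₂, hM₂⟩ := coeff_bdd (V k) w
    -- The common bosonic factor of both products: `p.1` indexes the current mode and `p.2` the
    -- block of the mode of `A`. As modes of `V` commute, it is the same in either order.
    set vv : ℤ × ℤ → FD := fun p =>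
      HVertexOperator.coeff (V m) (p.1 - n) (HVertexOperator.coeff (V k) (d - p.2) w) with hvv
    have hvv1 : ∀ p, p.1 < M₁ + n → vv p = 0 := fun p hp => by
      rw [hvv]; beta_reduce
      rw [commute_apply (commute_coeff_V _ _ _ _), hM₁ _ (by omega), map_zero]
    have hvv2 : ∀ p, d - M₂ < p.2 → vv p = 0 := fun p hp => by
      rw [hvv]; beta_reduce
      rw [hM₂ _ (by omega), map_zero]
    have hs1 : (Function.support fun p : ℤ × ℤ =>
        currentMode ℓ p.1 X (HVertexOperator.coeff A (e + p.2 * ℓ) v) ⊗ₜ[ℂ] vv p).Finite := by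
      -- The upper bound on the current index depends on the vector, hence on `r`; finiteness
      -- follows because `r` itself ranges over a finite interval. In `hs2` the two roles are
      -- exchanged.
      obtain ⟨R, hR⟩ := coeff_add_mul_bdd ℓ A e v
      refine ((Set.finite_Icc R (d - M₂)).biUnion fun r _ => (Set.finite_Icc (M₁ + n)
        (currentMode_bdd ℓ X (HVertexOperator.coeff A (e + r * ℓ) v)).choose).prod
          (Set.finite_singleton r)).subset ?_
      rintro ⟨s, r⟩ hp
      refine Set.mem_biUnion (x := r) ⟨?_, ?_⟩ ⟨⟨?_, ?_⟩, rfl⟩ <;> by_contra h <;> refine hp ?_ <;>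
        dsimp only at h ⊢
      · rw [hR _ (by omega), map_zero, TensorProduct.zero_tmul]
      · rw [hvv2 _ (not_le.1 h), TensorProduct.tmul_zero]
      · rw [hvv1 _ (not_le.1 h), TensorProduct.tmul_zero]
      · rw [(currentMode_bdd ℓ X _).choose_spec _ (not_le.1 h).le, TensorProduct.zero_tmul]
    have hs2 : (Function.support fun p : ℤ × ℤ =>
        HVertexOperator.coeff A (e + p.2 * ℓ) (currentMode ℓ p.1 X v) ⊗ₜ[ℂ] vv p).Finite := by
      obtain ⟨N, hN⟩ := currentMode_bdd ℓ X v
      refine ((Set.finite_Icc (M₁ + n) N).biUnion fun s _ => (Set.finite_singleton s).prod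
        (Set.finite_Icc (coeff_add_mul_bdd ℓ A e (currentMode ℓ s X v)).choose
          (d - M₂))).subset ?_
      rintro ⟨s, r⟩ hp
      refine Set.mem_biUnion (x := s) ⟨?_, ?_⟩ ⟨rfl, ?_, ?_⟩ <;> by_contra h <;> refine hp ?_ <;>
        dsimp only at h ⊢
      · rw [hvv1 _ (not_le.1 h), TensorProduct.tmul_zero]
      · rw [hN _ (by omega), map_zero, TensorProduct.zero_tmul]
      · rw [(coeff_add_mul_bdd ℓ A e _).choose_spec _ (not_le.1 h), TensorProduct.zero_tmul]
      · rw [hvv2 _ (not_le.1 h), TensorProduct.tmul_zero]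
    have hs3 : ∀ a, (Function.support fun p : ℤ × ℤ =>
        HVertexOperator.coeff A (E a + p.2 * ℓ) v ⊗ₜ[ℂ] vv (p.1, p.2 + p.1)).Finite := by
      intro a
      obtain ⟨R, hR⟩ := coeff_add_mul_bdd ℓ A (E a) v
      refine ((Set.finite_Icc (M₁ + n) (d - M₂ - R)).prod
        (Set.finite_Icc R (d - M₂ - M₁ - n))).subset ?_
      rintro ⟨s, t⟩ hp
      have h1 : M₁ + n ≤ s := not_lt.1 fun h => hp (by
        dsimp only; rw [hvv1 _ h, TensorProduct.tmul_zero])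
      have h2 : R ≤ t := not_lt.1 fun h => hp (by
        dsimp only; rw [hR _ h, TensorProduct.zero_tmul])
      have h3 : t + s ≤ d - M₂ := not_lt.1 fun h => hp (by
        dsimp only; rw [hvv2 _ h, TensorProduct.tmul_zero])
      exact ⟨⟨h1, by dsimp only; omega⟩, h2, by dsimp only; omega⟩
    have e1 : torMode ℓ n m X (HVertexOperator.coeff (tensorField A (substPow ℓ (V k)))
        (e + d * ℓ) (v ⊗ₜ[ℂ] w)) = ∑ᶠ p : ℤ × ℤ,
        currentMode ℓ p.1 X (HVertexOperator.coeff A (e + p.2 * ℓ) v) ⊗ₜ[ℂ] vv p := by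
      rw [coeff_tensorField_substPow, ← finsum_comp_equiv (Equiv.prodComm ℤ ℤ), finsum_curry]
      · refine (AddMonoidHom.map_finsum (torMode ℓ n m X).toAddMonoidHom
          (field_support_finite ℓ A e d k v w)).trans (finsum_congr fun r => ?_)
        exact torMode_tmul ℓ n m X _ _
      · exact hs1.preimage (Equiv.injective _).injOn
    have e2 : HVertexOperator.coeff (tensorField A (substPow ℓ (V k))) (e + d * ℓ)
        (torMode ℓ n m X (v ⊗ₜ[ℂ] w)) = ∑ᶠ p : ℤ × ℤ,
        HVertexOperator.coeff A (e + p.2 * ℓ) (currentMode ℓ p.1 X v) ⊗ₜ[ℂ] vv p := by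
      rw [torMode_tmul, finsum_curry _ hs2]
      refine (AddMonoidHom.map_finsum (HVertexOperator.coeff (tensorField A (substPow ℓ (V k)))
        (e + d * ℓ)).toAddMonoidHom (torMode_support_finite ℓ n m X v w)).trans
        (finsum_congr fun s => ?_)
      refine (coeff_tensorField_substPow ℓ A (V k) e d _ _).trans (finsum_congr fun r => ?_)
      rw [hvv]; beta_reduce
      rw [commute_apply (commute_coeff_V _ _ _ _)]
    have e3 : ∀ a, HVertexOperator.coeff (tensorField A (substPow ℓ (V (m + k))))
        (E a + (d - n) * ℓ) (v ⊗ₜ[ℂ] w) = ∑ᶠ p : ℤ × ℤ,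
        HVertexOperator.coeff A (E a + p.2 * ℓ) v ⊗ₜ[ℂ] vv (p.1, p.2 + p.1) := by
      intro a
      rw [coeff_tensorField_substPow, ← finsum_comp_equiv (Equiv.prodComm ℤ ℤ), finsum_curry]
      · refine finsum_congr fun t => ?_
        -- For fixed `t` the sum over `s` of the pairs `(s, t + s)` is the Cauchy product that fuses
        -- `V_m` and `V_k` into `V_{m+k}`.
        rw [← finsum_coeff_V_mul]
        refine (AddMonoidHom.map_finsum (TensorProduct.mk ℂ FA FD
          (HVertexOperator.coeff A (E a + t * ℓ) v)).toAddMonoidHom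
          (coeff_V_mul_support_finite m k _ w)).trans ?_
        rw [← finsum_comp_equiv (Equiv.subRight n)]
        refine finsum_congr fun s => ?_
        change HVertexOperator.coeff A (E a + t * ℓ) v ⊗ₜ[ℂ] HVertexOperator.coeff (V m) (s - n)
          (HVertexOperator.coeff (V k) (d - n - t - (s - n)) w) =
          HVertexOperator.coeff A (E a + t * ℓ) v ⊗ₜ[ℂ] HVertexOperator.coeff (V m) (s - n)
          (HVertexOperator.coeff (V k) (d - (t + s)) w)
        rw [show d - n - t - (s - n) = d - (t + s) by ring]
      · exact (hs3 a).preimage (Equiv.injective _).injOn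
    rw [e1, e2, ← finsum_sub_distrib hs1 hs2]
    simp_rw [e3, smul_finsum]
    rw [← finsum_sum_comm _ _ fun a _ => (hs3 a).subset fun p hp h => hp (by
      beta_reduce at h ⊢; rw [h, smul_zero])]
    -- The fermionic commutator lowers the block `r` by `s`; the new summation variable is `t = r -
    -- s`.
    have hbij : Function.Bijective fun p : ℤ × ℤ => ((p.1, p.2 - p.1) : ℤ × ℤ) :=
      Function.bijective_iff_has_inverse.2 ⟨fun p => (p.1, p.2 + p.1),
        fun p => by simp, fun p => by simp⟩
    refine finsum_eq_of_bijective _ hbij fun p => ?_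
    rw [← TensorProduct.sub_tmul, hA, TensorProduct.sum_tmul]
    refine Finset.sum_congr rfl fun a _ => ?_
    rw [TensorProduct.smul_tmul', sub_add_cancel]

end Intertwining

/-! ### Invariance of the terms of `Ω` under the diagonal action. -/

section Bilinear

variable (ℓ : ℕ) [NeZero ℓ]

theorem finsum_eq_finsum_sum_add_mul {M : Type*} [AddCommMonoid M] (F : ℤ → M)
    (hF : (Function.support F).Finite) :
    ∑ᶠ i, F i = ∑ᶠ d : ℤ, ∑ b : Fin ℓ, F ((b : ℕ) + d * ℓ) := by
  rw [← finsum_comp_equiv (Int.divModEquiv ℓ).symm, finsum_curry _ (hF.preimage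
    (Equiv.injective _).injOn)]
  refine finsum_congr fun d => ?_
  rw [finsum_eq_sum_of_fintype]
  refine Finset.sum_congr rfl fun b _ => ?_
  rw [← divModEquiv_add_mul ℓ b d, Equiv.symm_apply_apply]

theorem tensorField_support_finite {V W : Type*} [AddCommGroup V] [Module ℂ V] [AddCommGroup W]
    [Module ℂ W] (A : VertexOperator ℂ V) (B : VertexOperator ℂ W) (c : ℤ) (v : V) (w : W) :
    (Function.support fun i : ℤ =>
      HVertexOperator.coeff A i v ⊗ₜ[ℂ] HVertexOperator.coeff B (c - i) w).Finite :=
  tensor_support_finite A B c (v ⊗ₜ[ℂ] w)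

/-- The field `ψ(λ) V_k(λ^ℓ)`. -/
def psiV (k : ℤ) : VertexOperator ℂ FTor := tensorField psiField (substPow ℓ (V k))

/-- The field `ψ*(λ) V_k(λ^ℓ)`. -/
def psiStarV (k : ℤ) : VertexOperator ℂ FTor := tensorField psiStarField (substPow ℓ (V k))

theorem torMode_commutator_psiV (n m k d : ℤ) (X : SlAlg ℓ) (b : Fin ℓ) (u : FTor) :
    torMode ℓ n m X (HVertexOperator.coeff (psiV ℓ k) ((b : ℕ) + d * ℓ) u) -
      HVertexOperator.coeff (psiV ℓ k) ((b : ℕ) + d * ℓ) (torMode ℓ n m X u) =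
      ∑ a : Fin ℓ, X.1 a b • HVertexOperator.coeff (psiV ℓ (m + k)) ((a : ℕ) + (d - n) * ℓ) u :=
  torMode_commutator_of_current ℓ psiField X _ (fun a => (a : ℕ)) _
    (currentMode_commutator_psi ℓ X b) n m k d u

theorem torMode_commutator_psiStarV (n m k d : ℤ) (X : SlAlg ℓ) (a : Fin ℓ) (u : FTor) :
    torMode ℓ n m X (HVertexOperator.coeff (psiStarV ℓ k) (-1 - (a : ℕ) + d * ℓ) u) -
      HVertexOperator.coeff (psiStarV ℓ k) (-1 - (a : ℕ) + d * ℓ) (torMode ℓ n m X u) =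
      ∑ b : Fin ℓ, (-X.1 a b) •
        HVertexOperator.coeff (psiStarV ℓ (m + k)) (-1 - (b : ℕ) + (d - n) * ℓ) u :=
  torMode_commutator_of_current ℓ psiStarField X _ (fun b => -1 - (b : ℕ)) _
    (currentMode_commutator_psiStar ℓ X a) n m k d u

theorem coeff_omegaTerm_tmul (m c : ℤ) (v w : FTor) :
    HVertexOperator.coeff (omegaTerm ℓ m) c (v ⊗ₜ[ℂ] w) = ∑ᶠ i : ℤ,
      HVertexOperator.coeff (psiV ℓ m) i v ⊗ₜ[ℂ]
        HVertexOperator.coeff (psiStarV ℓ (-m)) (c - i) w :=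
  rfl

/-- The exponent `-1 - jℓ` pairs the `ψ` mode `b + dℓ` with the dual `ψ*` mode `-1 - b + (-j - d)ℓ`,
so both commutator formulas apply to the same terms. The right-hand side is shaped to match
`commutator_lTensor_omegaTerm` up to sign. -/
theorem commutator_rTensor_omegaTerm (n m k j : ℤ) (X : SlAlg ℓ) (v w : FTor) :
    LinearMap.rTensor FTor (torMode ℓ n m X)
        (HVertexOperator.coeff (omegaTerm ℓ k) (-1 - j * ℓ) (v ⊗ₜ[ℂ] w)) -
      HVertexOperator.coeff (omegaTerm ℓ k) (-1 - j * ℓ) (torMode ℓ n m X v ⊗ₜ[ℂ] w) =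
    ∑ᶠ d : ℤ, ∑ a : Fin ℓ, ∑ b : Fin ℓ, X.1 a b •
      (HVertexOperator.coeff (psiV ℓ (m + k)) ((a : ℕ) + d * ℓ) v ⊗ₜ[ℂ]
        HVertexOperator.coeff (psiStarV ℓ (-k)) (-1 - (b : ℕ) + (-j - d - n) * ℓ) w) := by
  have h0 := tensorField_support_finite (psiV ℓ k) (psiStarV ℓ (-k)) (-1 - j * ℓ) v w
  have h1 := support_map_finite (LinearMap.rTensor FTor (torMode ℓ n m X)) h0
  have h2 := tensorField_support_finite (psiV ℓ k) (psiStarV ℓ (-k)) (-1 - j * ℓ)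
    (torMode ℓ n m X v) w
  rw [coeff_omegaTerm_tmul, coeff_omegaTerm_tmul]
  refine (congrArg (· - _) (AddMonoidHom.map_finsum
    (LinearMap.rTensor FTor (torMode ℓ n m X)).toAddMonoidHom h0)).trans ?_
  refine (finsum_sub_distrib h1 h2).symm.trans ?_
  -- The shift of `d` by `n` compensates the block shift in the commutator, so that the first leg
  -- ends up in block `d`.
  rw [finsum_eq_finsum_sum_add_mul ℓ _ ((h1.union h2).subset (Function.support_sub _ _)),
    ← finsum_comp_equiv (Equiv.addRight n)]
  refine finsum_congr fun d => ?_
  rw [Finset.sum_comm]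
  refine Finset.sum_congr rfl fun b _ => ?_
  change torMode ℓ n m X (HVertexOperator.coeff (psiV ℓ k) ((b : ℕ) + (d + n) * ℓ) v) ⊗ₜ[ℂ]
    HVertexOperator.coeff (psiStarV ℓ (-k)) (-1 - j * ℓ - ((b : ℕ) + (d + n) * ℓ)) w -
    HVertexOperator.coeff (psiV ℓ k) ((b : ℕ) + (d + n) * ℓ) (torMode ℓ n m X v) ⊗ₜ[ℂ]
    HVertexOperator.coeff (psiStarV ℓ (-k)) (-1 - j * ℓ - ((b : ℕ) + (d + n) * ℓ)) w = _
  rw [← TensorProduct.sub_tmul, torMode_commutator_psiV, TensorProduct.sum_tmul]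
  refine Finset.sum_congr rfl fun a _ => ?_
  rw [TensorProduct.smul_tmul', add_sub_cancel_right,
    show -1 - j * (ℓ : ℤ) - ((b : ℕ) + (d + n) * ℓ) = -1 - (b : ℕ) + (-j - d - n) * ℓ by ring]

theorem commutator_lTensor_omegaTerm (n m k j : ℤ) (X : SlAlg ℓ) (v w : FTor) :
    LinearMap.lTensor FTor (torMode ℓ n m X)
        (HVertexOperator.coeff (omegaTerm ℓ (m + k)) (-1 - j * ℓ) (v ⊗ₜ[ℂ] w)) -
      HVertexOperator.coeff (omegaTerm ℓ (m + k)) (-1 - j * ℓ) (v ⊗ₜ[ℂ] torMode ℓ n m X w) =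
    -∑ᶠ d : ℤ, ∑ a : Fin ℓ, ∑ b : Fin ℓ, X.1 a b •
      (HVertexOperator.coeff (psiV ℓ (m + k)) ((a : ℕ) + d * ℓ) v ⊗ₜ[ℂ]
        HVertexOperator.coeff (psiStarV ℓ (-k)) (-1 - (b : ℕ) + (-j - d - n) * ℓ) w) := by
  have h0 := tensorField_support_finite (psiV ℓ (m + k)) (psiStarV ℓ (-(m + k))) (-1 - j * ℓ) v w
  have h1 := support_map_finite (LinearMap.lTensor FTor (torMode ℓ n m X)) h0
  have h2 := tensorField_support_finite (psiV ℓ (m + k)) (psiStarV ℓ (-(m + k))) (-1 - j * ℓ) v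
    (torMode ℓ n m X w)
  rw [coeff_omegaTerm_tmul, coeff_omegaTerm_tmul]
  refine (congrArg (· - _) (AddMonoidHom.map_finsum
    (LinearMap.lTensor FTor (torMode ℓ n m X)).toAddMonoidHom h0)).trans ?_
  refine (finsum_sub_distrib h1 h2).symm.trans ?_
  rw [finsum_eq_finsum_sum_add_mul ℓ _ ((h1.union h2).subset (Function.support_sub _ _)),
    ← finsum_neg_distrib]
  refine finsum_congr fun d => ?_
  rw [← Finset.sum_neg_distrib]
  refine Finset.sum_congr rfl fun a _ => ?_
  change HVertexOperator.coeff (psiV ℓ (m + k)) ((a : ℕ) + d * ℓ) v ⊗ₜ[ℂ]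
    torMode ℓ n m X (HVertexOperator.coeff (psiStarV ℓ (-(m + k)))
    (-1 - j * ℓ - ((a : ℕ) + d * ℓ)) w) - HVertexOperator.coeff (psiV ℓ (m + k))
    ((a : ℕ) + d * ℓ) v ⊗ₜ[ℂ] _ = _
  rw [← TensorProduct.tmul_sub,
    show -1 - j * (ℓ : ℤ) - ((a : ℕ) + d * ℓ) = -1 - (a : ℕ) + (-j - d) * ℓ by ring,
    torMode_commutator_psiStarV, TensorProduct.tmul_sum, ← Finset.sum_neg_distrib,
    show m + -(m + k) = -k by ring]
  refine Finset.sum_congr rfl fun b _ => ?_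
  rw [TensorProduct.tmul_smul]
  exact neg_smul (X.1 a b : ℂ) (_ : FTor ⊗[ℂ] FTor)

/-- The operator `A ⊗ 1 + 1 ⊗ A`. -/
def diagonal {M : Type*} [AddCommGroup M] [Module ℂ M] :
    Module.End ℂ M →ₗ[ℂ] Module.End ℂ (M ⊗[ℂ] M) :=
  LinearMap.rTensorHom M + LinearMap.lTensorHom M

theorem diagonal_apply {M : Type*} [AddCommGroup M] [Module ℂ M] (A : Module.End ℂ M) :
    diagonal A = LinearMap.rTensor M A + LinearMap.lTensor M A := rfl

/-- No single term of `Ω` is invariant: the charge `m` added to the first leg of term `k` must be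
compared with the same charge added to the second leg of term `m + k`. The two resulting commutators
cancel. -/
theorem omegaTerm_commutator (n m k j : ℤ) (X : SlAlg ℓ) (u : FTor ⊗[ℂ] FTor) :
    HVertexOperator.coeff (omegaTerm ℓ k) (-1 - j * ℓ)
        (LinearMap.rTensor FTor (torMode ℓ n m X) u) +
      HVertexOperator.coeff (omegaTerm ℓ (m + k)) (-1 - j * ℓ)
        (LinearMap.lTensor FTor (torMode ℓ n m X) u) =
    LinearMap.rTensor FTor (torMode ℓ n m X)
        (HVertexOperator.coeff (omegaTerm ℓ k) (-1 - j * ℓ) u) +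
      LinearMap.lTensor FTor (torMode ℓ n m X)
        (HVertexOperator.coeff (omegaTerm ℓ (m + k)) (-1 - j * ℓ) u) := by
  induction u using TensorProduct.induction_on with
  | zero => simp only [map_zero]
  | tmul v w =>
    have h1 := commutator_rTensor_omegaTerm ℓ n m k j X v w
    have h2 := commutator_lTensor_omegaTerm ℓ n m k j X v w
    rw [← h1] at h2
    rw [LinearMap.rTensor_tmul, LinearMap.lTensor_tmul, ← sub_eq_zero]
    rw [← add_eq_zero_iff_eq_neg] at h2
    rw [← neg_eq_zero, ← h2]
    abel
  | add x y hx hy =>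
    simp only [map_add]
    rw [add_add_add_comm, hx, hy, add_add_add_comm]

/-! ### Passage to the completion, one power of `e^{y₀}` at a time. -/

/-- The embedding `f ⊗ p ↦ f ⊗ p e^{a y₀}`. -/
def chargeIncl (a : ℤ) : FA ⊗[ℂ] YPoly →ₗ[ℂ] FTor :=
  LinearMap.lTensor FA ((TensorProduct.mk ℂ YPoly ℂ[T;T⁻¹]).flip (LaurentPolynomial.T a))

theorem chargeCoeff_chargeIncl (a : ℤ) (y : FA ⊗[ℂ] YPoly) :
    chargeCoeff a (chargeIncl a y) = y := by
  induction y using TensorProduct.induction_on with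
  | zero => simp only [map_zero]
  | tmul f p =>
    change f ⊗ₜ[ℂ] ((LaurentPolynomial.T a : ℂ[T;T⁻¹]).coeff a • p) = f ⊗ₜ[ℂ] p
    rw [LaurentPolynomial.T, AddMonoidAlgebra.coeff_single, Finsupp.single_eq_same, one_smul]
  | add x y hx hy => rw [map_add, map_add, hx, hy]

theorem chargeCoeff_torMode_eq_zero (n m a : ℤ) (X : SlAlg ℓ) {v : FTor}
    (h : chargeCoeff (a - m) v = 0) : chargeCoeff a (torMode ℓ n m X v) = 0 := by
  refine (map_locSum (chargeCoeff a) _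
    (tensor_support_finite (currentField ℓ X) (V m) (-n - 1)) v).trans
    ((finsum_congr fun i => ?_).trans finsum_zero)
  exact (chargeCoeff_map a m _ _ v).trans (by rw [h, map_zero])

/-- The operator induced by `X sⁿ tᵐ` on the coefficients of `e^{a y₀}`. -/
def torModeCoeff (n m a : ℤ) (X : SlAlg ℓ) : Module.End ℂ (FA ⊗[ℂ] YPoly) :=
  chargeCoeff a ∘ₗ torMode ℓ n m X ∘ₗ chargeIncl (a - m)

/-- A vector and the embedding of its `(a - m)`-th coefficient differ by a vector whose `(a - m)`-th
coefficient vanishes, and such vectors do not contribute. The mode thus acts coefficientwise, as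
required for infinite sums over the charges. -/
theorem chargeCoeff_torMode (n m a : ℤ) (X : SlAlg ℓ) :
    chargeCoeff a ∘ₗ torMode ℓ n m X = torModeCoeff ℓ n m a X ∘ₗ chargeCoeff (a - m) := by
  refine LinearMap.ext fun v => sub_eq_zero.1 ?_
  have h := chargeCoeff_torMode_eq_zero ℓ n m a X (v := v - chargeIncl (a - m)
    (chargeCoeff (a - m) v)) (by rw [map_sub, chargeCoeff_chargeIncl, sub_self])
  rw [map_sub, map_sub] at h
  exact h

theorem chargeCoeff2_rTensor_torMode (n m : ℤ) (p : ℤ × ℤ) (X : SlAlg ℓ) (u : FTor ⊗[ℂ] FTor) :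
    chargeCoeff2 p (LinearMap.rTensor FTor (torMode ℓ n m X) u) =
      LinearMap.rTensor (FA ⊗[ℂ] YPoly) (torModeCoeff ℓ n m p.1 X)
        (chargeCoeff2 (p.1 - m, p.2) u) := by
  rw [← LinearMap.comp_apply, ← LinearMap.comp_apply, chargeCoeff2, chargeCoeff2,
    LinearMap.map_comp_rTensor, LinearMap.rTensor_comp_map, chargeCoeff_torMode]

theorem chargeCoeff2_lTensor_torMode (n m : ℤ) (p : ℤ × ℤ) (X : SlAlg ℓ) (u : FTor ⊗[ℂ] FTor) :
    chargeCoeff2 p (LinearMap.lTensor FTor (torMode ℓ n m X) u) =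
      LinearMap.lTensor (FA ⊗[ℂ] YPoly) (torModeCoeff ℓ n m p.2 X)
        (chargeCoeff2 (p.1, p.2 - m) u) := by
  rw [← LinearMap.comp_apply, ← LinearMap.comp_apply, chargeCoeff2, chargeCoeff2,
    LinearMap.map_comp_lTensor, LinearMap.lTensor_comp_map, chargeCoeff_torMode]

theorem omegaTor_apply (c : ℤ) (u : FTor ⊗[ℂ] FTor) (p : ℤ × ℤ) :
    omegaTor ℓ c u p =
      ∑ᶠ m : ℤ, chargeCoeff2 p (HVertexOperator.coeff (omegaTerm ℓ m) c u) := rfl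

theorem omegaTor_diagonal_torMode (n m j : ℤ) (X : SlAlg ℓ) {u : FTor ⊗[ℂ] FTor}
    (hu : omegaTor ℓ (-1 - j * ℓ) u = 0) :
    omegaTor ℓ (-1 - j * ℓ) (diagonal (torMode ℓ n m X) u) = 0 := by
  funext p
  set c : ℤ := -1 - j * ℓ with hc
  have hf := omega_support_finite ℓ c p
  have f1 := hf (LinearMap.rTensor FTor (torMode ℓ n m X) u)
  have f2 := (hf (LinearMap.lTensor FTor (torMode ℓ n m X) u)).preimage
    (Equiv.addLeft m).injective.injOn
  have g1 := support_map_finite (LinearMap.rTensor (FA ⊗[ℂ] YPoly) (torModeCoeff ℓ n m p.1 X))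
    (omega_support_finite ℓ c (p.1 - m, p.2) u)
  have g2 := support_map_finite (LinearMap.lTensor (FA ⊗[ℂ] YPoly) (torModeCoeff ℓ n m p.2 X))
    (omega_support_finite ℓ c (p.1, p.2 - m) u)
  rw [diagonal_apply, LinearMap.add_apply, map_add, Pi.add_apply, omegaTor_apply, omegaTor_apply,
    ← finsum_comp_equiv (Equiv.addLeft m) (f := fun k => chargeCoeff2 p
      (HVertexOperator.coeff (omegaTerm ℓ k) c (LinearMap.lTensor FTor (torMode ℓ n m X) u)))]
  refine (finsum_add_distrib f1 f2).symm.trans ?_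
  -- After reindexing the second sum by `k ↦ m + k`, the termwise identity applies. Summed over `k`,
  -- the right-hand side consists of fixed operators applied to the coefficients of `Ω u` at `(p.1 -
  -- m, p.2)` and `(p.1, p.2 - m)`, both of which vanish.
  have e : ∀ k, chargeCoeff2 p (HVertexOperator.coeff (omegaTerm ℓ k) c
        (LinearMap.rTensor FTor (torMode ℓ n m X) u)) +
      chargeCoeff2 p (HVertexOperator.coeff (omegaTerm ℓ (m + k)) c
        (LinearMap.lTensor FTor (torMode ℓ n m X) u)) =
      LinearMap.rTensor (FA ⊗[ℂ] YPoly) (torModeCoeff ℓ n m p.1 X)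
        (chargeCoeff2 (p.1 - m, p.2) (HVertexOperator.coeff (omegaTerm ℓ k) c u)) +
      LinearMap.lTensor (FA ⊗[ℂ] YPoly) (torModeCoeff ℓ n m p.2 X)
        (chargeCoeff2 (p.1, p.2 - m) (HVertexOperator.coeff (omegaTerm ℓ (m + k)) c u)) := by
    intro k
    rw [← map_add, omegaTerm_commutator, map_add, chargeCoeff2_rTensor_torMode,
      chargeCoeff2_lTensor_torMode]
  refine (finsum_congr e).trans ?_
  refine (finsum_add_distrib g1 (g2.preimage (Equiv.addLeft m).injective.injOn)).trans ?_
  have z : ∀ q, omegaTor ℓ c u q = 0 := fun q => by rw [hu]; rfl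
  have e1 := (AddMonoidHom.map_finsum (LinearMap.rTensor (FA ⊗[ℂ] YPoly)
    (torModeCoeff ℓ n m p.1 X)).toAddMonoidHom
    (omega_support_finite ℓ c (p.1 - m, p.2) u)).symm.trans
      ((congrArg _ (z (p.1 - m, p.2))).trans (map_zero _))
  have e2 := (AddMonoidHom.map_finsum (LinearMap.lTensor (FA ⊗[ℂ] YPoly)
    (torModeCoeff ℓ n m p.2 X)).toAddMonoidHom
    (omega_support_finite ℓ c (p.1, p.2 - m) u)).symm.trans
      ((congrArg _ (z (p.1, p.2 - m))).trans (map_zero _))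
  refine (congrArg₂ (· + ·) e1 ?_).trans (add_zero 0)
  exact (finsum_comp_equiv (Equiv.addLeft m)).trans e2

/-! ### From the Lie algebra action to the group. -/

/-- The operators `A` for which `A ⊗ 1 + 1 ⊗ A` preserves a given subspace. -/
def diagonalStabilizer {M : Type*} [AddCommGroup M] [Module ℂ M] (K : Submodule ℂ (M ⊗[ℂ] M)) :
    Submodule ℂ (Module.End ℂ M) where
  carrier := {A | ∀ u ∈ K, diagonal A u ∈ K}
  zero_mem' u _ := by rw [map_zero, LinearMap.zero_apply]; exact K.zero_mem
  add_mem' hA hB u hu := by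
    rw [map_add, LinearMap.add_apply]
    exact K.add_mem (hA u hu) (hB u hu)
  smul_mem' c A hA u hu := by
    rw [map_smul, LinearMap.smul_apply]
    exact K.smul_mem c (hA u hu)

theorem torAction_tmul (X : SlAlg ℓ) (r : LaurentST) : torAction ℓ (X ⊗ₜ[ℂ] r) =
    ∑ p ∈ r.coeff.support, r.coeff p • torMode ℓ p.1 p.2 X := by
  rw [torAction, TensorProduct.lift.tmul]
  change (Finsupp.linearCombination ℂ (fun p : ℤ × ℤ => torMode ℓ p.1 p.2) r.coeff) X = _
  rw [Finsupp.linearCombination_apply, Finsupp.sum, LinearMap.sum_apply]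
  rfl

theorem torAction_mem_diagonalStabilizer (j : ℤ) (x : SlAlg ℓ ⊗[ℂ] LaurentST) :
    torAction ℓ x ∈ diagonalStabilizer (LinearMap.ker (omegaTor ℓ (-1 - j * ℓ))) := by
  induction x using TensorProduct.induction_on with
  | zero => rw [map_zero]; exact Submodule.zero_mem _
  | tmul X r =>
    rw [torAction_tmul]
    exact Submodule.sum_mem _ fun p _ => Submodule.smul_mem _ _ fun u hu =>
      omegaTor_diagonal_torMode ℓ p.1 p.2 j X hu
  | add x y hx hy => rw [map_add]; exact Submodule.add_mem _ hx hy

theorem expApply_tmul_expApply_mem {M : Type*} [AddCommGroup M] [Module ℂ M]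
    {K : Submodule ℂ (M ⊗[ℂ] M)} {A : Module.End ℂ M} (hA : LocallyNilpotent A)
    (hK : A ∈ diagonalStabilizer K) {v : M} (hv : v ⊗ₜ[ℂ] v ∈ K) :
    expApply A v ⊗ₜ[ℂ] expApply A v ∈ K := by
  rw [expApply_tmul hA hA]
  exact expApply_mem K hK hv

theorem SLTor_tmul_mem (j : ℤ) {g : FTor ≃ₗ[ℂ] FTor} (hg : g ∈ SLTor ℓ) :
    ∀ v : FTor, v ⊗ₜ[ℂ] v ∈ LinearMap.ker (omegaTor ℓ (-1 - j * ℓ)) →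
      g v ⊗ₜ[ℂ] g v ∈ LinearMap.ker (omegaTor ℓ (-1 - j * ℓ)) := by
  induction hg using Subgroup.closure_induction'' with
  | one => exact fun v hv => hv
  | mem g hg =>
    obtain ⟨x, hx, hgx⟩ := hg
    intro v hv
    rw [hgx]
    exact expApply_tmul_expApply_mem hx (torAction_mem_diagonalStabilizer ℓ j x) hv
  | inv_mem g hg =>
    obtain ⟨x, hx, hgx⟩ := hg
    intro v hv
    -- The inverse of a generator is again an exponential, since `x` and `-x` act by commuting
    -- locally nilpotent operators with sum zero.
    have e : g⁻¹ v = expApply (-torAction ℓ x) v := by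
      refine g.injective ?_
      rw [hgx (expApply _ v), expApply_add hx hx.neg (Commute.refl (torAction ℓ x)).neg_right,
        add_neg_cancel, expApply_zero]
      exact g.apply_symm_apply v
    rw [e]
    exact expApply_tmul_expApply_mem hx.neg
      (Submodule.neg_mem _ (torAction_mem_diagonalStabilizer ℓ j x)) hv
  | mul g h _ _ hg hh => exact fun v hv => hg _ (hh v hv)

/-! ### The bilinear identity on the vacuum. -/

theorem annihilationCoeff_one (m : ℤ) {b : ℕ} (hb : 1 ≤ b) : annihilationCoeff m b 1 = 0 := by
  have h1 : (1 : YPoly) ∈ weightLE 0 :=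
    Submodule.subset_span ⟨0, 1, le_rfl, rfl⟩
  -- The vacuum has weight `0` and this operator lowers weights by `b ≥ 1`, while no nonzero
  -- polynomial has negative weight.
  have h : annihilationCoeff m b 1 ∈ weightLE (0 - b) := by
    rw [annihilationCoeff, expSeries, PowerSeries.coeff_mk, LinearMap.sum_apply]
    exact Submodule.sum_mem _ fun k _ =>
      Submodule.smul_mem _ _ (annihilationExponent_pow_mem m k b h1)
  rw [weightLE_neg (by omega)] at h
  exact h

theorem coeff_V_vacD (m : ℤ) {k : ℤ} (hk : k < 0) : HVertexOperator.coeff (V m) k vacD = 0 := by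
  change vertexCoeff m k 1 ⊗ₜ[ℂ] _ = 0
  rw [vertexCoeff_eq_sum m k fun b hb => annihilationCoeff_one m hb, Finset.sum_range_one,
    Nat.cast_zero, add_zero, creationCoeff_of_neg m hk, LinearMap.zero_apply,
    TensorProduct.zero_tmul]

theorem act_gen_vacA {x : ℤ ⊕ ℤ} (hx : gen x ∈ vacuumIdeal) : act (gen x) vacA = 0 := by
  change gen x • vacuumIdeal.mkQ 1 = 0
  rw [← map_smul, smul_eq_mul, mul_one]
  exact (Submodule.Quotient.mk_eq_zero _).2 hx

theorem coeff_psiField_vacA {a : ℤ} (ha : a < 0) : HVertexOperator.coeff psiField a vacA = 0 :=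
  act_gen_vacA (Ideal.subset_span ⟨-a - 1, by omega, Or.inl rfl⟩)

theorem coeff_psiStarField_vacA {a : ℤ} (ha : a < 0) :
    HVertexOperator.coeff psiStarField a vacA = 0 :=
  act_gen_vacA (Ideal.subset_span ⟨-a - 1, by omega, Or.inr rfl⟩)

theorem coeff_tensorField_tmul_eq_zero {V W : Type*} [AddCommGroup V] [Module ℂ V] [AddCommGroup W]
    [Module ℂ W] {A : VertexOperator ℂ V} {B : VertexOperator ℂ W} {v : V} {w : W}
    (hA : ∀ a < 0, HVertexOperator.coeff A a v = 0)
    (hB : ∀ b < 0, HVertexOperator.coeff B b w = 0) {k : ℤ} (hk : k < 0) :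
    HVertexOperator.coeff (tensorField A B) k (v ⊗ₜ[ℂ] w) = 0 := by
  rw [coeff_tensorField_tmul]
  refine (finsum_congr fun a => ?_).trans finsum_zero
  rcases lt_or_ge a 0 with h | h
  · rw [hA a h, TensorProduct.zero_tmul]
  · rw [hB _ (by omega), TensorProduct.tmul_zero]

theorem coeff_substPow_V_vacD (m : ℤ) (c : ℤ) (hc : c < 0) :
    HVertexOperator.coeff (substPow ℓ (V m)) c vacD = 0 := by
  rw [coeff_substPow]
  split_ifs
  · exact coeff_V_vacD m (Int.ediv_neg_of_neg_of_pos hc (by exact_mod_cast Nat.pos_of_neZero ℓ))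
  · rfl

theorem omegaTor_vacTor {c : ℤ} (hc : c < 0) : omegaTor ℓ c (vacTor ⊗ₜ[ℂ] vacTor) = 0 := by
  funext p
  rw [omegaTor_apply]
  refine (finsum_congr fun m => ?_).trans finsum_zero
  have h : HVertexOperator.coeff (omegaTerm ℓ m) c (vacTor ⊗ₜ[ℂ] vacTor) = 0 :=
    coeff_tensorField_tmul_eq_zero
      (fun _ h => coeff_tensorField_tmul_eq_zero (fun _ => coeff_psiField_vacA)
        (coeff_substPow_V_vacD ℓ m) h)
      (fun _ h => coeff_tensorField_tmul_eq_zero (fun _ => coeff_psiStarField_vacA)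
        (coeff_substPow_V_vacD ℓ (-m)) h) hc
  rw [h, map_zero]

end Bilinear

end Toroidal

end

theorem mainTheorem7 (ℓ : ℕ) [NeZero ℓ] (hℓ : 2 ≤ ℓ) (τ : Toroidal.FTor)
    (hτ : τ ∈ MulAction.orbit (Toroidal.SLTor ℓ) Toroidal.vacTor) (j : ℕ) :
    Toroidal.contourIntegral (j * ℓ) (fun c => Toroidal.omegaTor ℓ c (τ ⊗ₜ[ℂ] τ)) = 0 := by
  obtain ⟨⟨g, hg⟩, rfl⟩ := hτ
  -- The contour integral unfolds to the coefficient of `λ^{-1-jℓ}`. Invariance holds for every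
  -- integer `j`; the condition `j ≥ 0` enters only through the negativity of this exponent on the
  -- vacuum.
  refine Toroidal.SLTor_tmul_mem ℓ j hg Toroidal.vacTor (Toroidal.omegaTor_vacTor ℓ ?_)
  have : (0 : ℤ) ≤ j * ℓ := by positivity
  omega
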